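/- Let $M$ be a deterministic MDP with $n\ge 1$ states and $k\ge 1$ actions: action $a$ in state $s$ leads to the state $s'=s'(s,a)$ and earns the real reward $r(s,a)$. For a policy $\pi:S\to A$ and $\gamma\in[0,1)$ let $V^\pi_\gamma(s)$ be the discounted sum of the rewards earned from $s$ under $\pi$. A policy $\pi$ is Blackwell optimal if there is $\gamma_0\in[0,1)$ with $V^\pi_\gamma(s)\ge V^{\pi'}_\gamma(s)$ for all $\gamma\in[\gamma_0,1)$, all states $s$ and all policies $\pi'$. For real rational functions $r_1,r_2$ of $\gamma$ write $r_1-r_2=\frac{(1-\gamma)^{c_1}\bar\eta(\gamma)}{(1-\gamma)^{c_2}\bar\delta(\gamma)}$ with polynomials $\bar\eta,\bar\delta$ not vanishing at $1$, if $r_1\neq r_2$; put $r_1\succ r_2$ iff $r_1\ne r_2$ and $\bar\eta(1)\bar\delta(1)>0$ (the $\mu$-ordering). Let $\widehat{\max},\widehat{\min},\widehat{\arg\max}$ refer to this total order. The procedure DetMDP2-Blackwell treats $\gamma$ as an indeterminate and computes, for all states $s$, 1. $d_0(s)=0$ and, for $i=1,\dots,n$, $d_i(s)=\widehat{\max}_{a}\,\bigl(r(s,a)+\gamma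 d_{i-1}(s'(s,a))\bigr)$, with a maximising action $\bar\alpha_i(s)$; 2. $y_0(s)=\widehat{\min}_{0\le i\le n-1}\dfrac{d_n(s)-\gamma^{n-i}d_i(s)}{1-\gamma^{n-i}}$ and $\bar a_0(s)=\bar\alpha_n(s)$; 3. for $i=1,\dots,n-1$, $y_i(s)=\widehat{\max}_{a}\,\bigl(r(s,a)+\gamma y_{i-1}(s'(s,a))\bigr)$, with a maximising action $\bar a_i(s)$; 4. $\bar i_s\in\widehat{\arg\max}_{0\le i\le n-1}\,y_i(s)$, and returns the policy $\pi(s)=\bar a_{\bar i_s}(s)$. **Theorem.** However ties are broken, the policy that DetMDP2-Blackwell returns is Blackwell optimal. Moreover the procedure runs in time $O(n^4k)$: with rational functions represented by coefficient lists of numerator and denominator, and two of them compared by forming their difference, dividing out the factors $1-\gamma$ by Horner's scheme and comparing signs at $1$, it executes at most $C\,n^4k$ elementary steps (additions, subtractions, multiplications and comparisons of real numbers, loading the constants $0$ and $1$, loop iterations and index operations), where $C$ is an absolute constant. In particular the number of steps is bounded by a polynomial in $n,k$ alone, independently of the rewards. -/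

import Mathlib

open scoped Polynomial

/-! ### Finite Markov decision problems and Blackwell optimality -/

/-- A finite MDP `(S, A, T, R)`: transition probabilities `T s a s'` and mean rewards `R s a`. -/
structure FiniteMDP (S A : Type) [Fintype S] where
  T : S → A → S → ℝ
  R : S → A → ℝ
  T_nonneg : ∀ s a s', 0 ≤ T s a s'
  T_sum : ∀ s a, ∑ s', T s a s' = 1

namespace FiniteMDP

variable {S A : Type} [Fintype S] [DecidableEq S]

/-- The stochastic matrix of the (stationary, deterministic) policy `π`. -/
def transition (M : FiniteMDP S A) (π : S → A) : Matrix S S ℝ :=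
  Matrix.of fun s s' => M.T s (π s) s'

/-- The discounted value of `π` at `s`. Row `s` of the `t`-th power of the transition matrix is
the law of the state at time `t` when the initial state is `s`, so the `t`-th term is `γ ^ t`
times the expected reward at time `t`. -/
noncomputable def value (M : FiniteMDP S A) (π : S → A) (γ : ℝ) (s : S) : ℝ :=
  ∑' t : ℕ, γ ^ t * (M.transition π ^ t).mulVec (fun s' => M.R s' (π s')) s

def IsBlackwellOptimal (M : FiniteMDP S A) (π : S → A) : Prop :=
  ∃ γ₀ : ℝ, 0 ≤ γ₀ ∧ γ₀ < 1 ∧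
    ∀ γ : ℝ, γ₀ ≤ γ → γ < 1 → ∀ (π' : S → A) (s : S), M.value π' γ s ≤ M.value π γ s

end FiniteMDP

/-- A deterministic MDP with `n` states and `k` actions: action `a` in state `s` leads to
`next s a` and earns `reward s a`. Rewards live in an arbitrary type `K`, so that the same
structure serves as the input of the procedure below, which treats numbers as opaque. -/
structure DMDP (K : Type) (n k : ℕ) where
  next : Fin n → Fin k → Fin n
  reward : Fin n → Fin k → K

/-- A deterministic MDP with real rewards, as an MDP with zero-one transition probabilities. -/
def DMDP.toMDP {n k : ℕ} (M : DMDP ℝ n k) : FiniteMDP (Fin n) (Fin k) where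
  T s a s' := if s' = M.next s a then 1 else 0
  R := M.reward
  T_nonneg s a s' := by split_ifs <;> norm_num
  T_sum s a := by simp

/-! ### The ordering of rational functions to the left of `1`, and the procedure -/

/-- `MuGT r₁ r₂` is `r₁ ≻ r₂`: write `r₁ - r₂ = (1-x)^c₁ η(x) / ((1-x)^c₂ δ(x))` with `η(1)` and
`δ(1)` nonzero; then `η(1) δ(1) > 0`. (The sign does not depend on the representation.) -/
def MuGT (r₁ r₂ : RatFunc ℝ) : Prop :=
  ∃ (c₁ c₂ : ℕ) (η δ : ℝ[X]), 0 < η.eval 1 * δ.eval 1 ∧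
    r₁ - r₂ = algebraMap ℝ[X] (RatFunc ℝ) ((1 - Polynomial.X) ^ c₁ * η) /
      algebraMap ℝ[X] (RatFunc ℝ) ((1 - Polynomial.X) ^ c₂ * δ)

/-- `i` is a maximiser of `f` over the index set `I`, for the ordering `MuGT`. -/
def IsMuArgmax {ι : Type} (I : Set ι) (f : ι → RatFunc ℝ) (i : ι) : Prop :=
  i ∈ I ∧ ∀ j ∈ I, ¬ MuGT (f j) (f i)

/-- `i` is a minimiser of `f` over the index set `I`, for the ordering `MuGT`. -/
def IsMuArgmin {ι : Type} (I : Set ι) (f : ι → RatFunc ℝ) (i : ι) : Prop :=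
  i ∈ I ∧ ∀ j ∈ I, ¬ MuGT (f i) (f j)

namespace DMDP

variable {n k : ℕ}

/-- The rational function `r(s, a, s') + γ f(s')` with `s'` the successor of `s` under `a`. -/
noncomputable def backup (M : DMDP ℝ n k) (f : Fin n → RatFunc ℝ) (s : Fin n) (a : Fin k) :
    RatFunc ℝ :=
  RatFunc.C (M.reward s a) + RatFunc.X * f (M.next s a)

/-- The variables `d_i(s)`, `y_i(s)`, the recorded actions `α_i(s)`, `a_i(s)`, the indices `ib s`
and the returned policy `π` are those of a run of the procedure. The discount factor is the
indeterminate `RatFunc.X`. Ties in a maximum or minimum may be broken in any way. -/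
structure IsDetMDP2Run (M : DMDP ℝ n k) (d y : ℕ → Fin n → RatFunc ℝ)
    (α a : ℕ → Fin n → Fin k) (ib : Fin n → ℕ) (π : Fin n → Fin k) : Prop where
  d_zero : ∀ s, d 0 s = 0
  alpha_argmax : ∀ i < n, ∀ s, IsMuArgmax Set.univ (M.backup (d i) s) (α (i + 1) s)
  d_succ : ∀ i < n, ∀ s, d (i + 1) s = M.backup (d i) s (α (i + 1) s)
  y_zero : ∀ s, ∃ j, IsMuArgmin (Set.Iio n)
      (fun i => (d n s - RatFunc.X ^ (n - i) * d i s) / (1 - RatFunc.X ^ (n - i))) j ∧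
    y 0 s = (d n s - RatFunc.X ^ (n - j) * d j s) / (1 - RatFunc.X ^ (n - j))
  a_zero : ∀ s, a 0 s = α n s
  a_argmax : ∀ i, i + 1 < n → ∀ s, IsMuArgmax Set.univ (M.backup (y i) s) (a (i + 1) s)
  y_succ : ∀ i, i + 1 < n → ∀ s, y (i + 1) s = M.backup (y i) s (a (i + 1) s)
  ib_argmax : ∀ s, IsMuArgmax (Set.Iio n) (fun i => y i s) (ib s)
  output : ∀ s, π s = a (ib s) s

/-- `π` can be returned by the procedure DetMDP2-Blackwell on the input `M`. -/
def IsDetMDP2Output (M : DMDP ℝ n k) (π : Fin n → Fin k) : Prop :=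
  ∃ d y α a ib, M.IsDetMDP2Run d y α a ib π

end DMDP

/-! ### Arithmetic programs with a step count -/

/-- A program of an arithmetic random access machine over numbers of type `K`, with result in `α`.
Programs are written uniformly in `K`: numbers can only be created, combined and compared by the
instructions below. Each instruction costs one step. `tick` is one elementary step of control
(a loop iteration with its memory accesses, or an operation on indices or signs). -/
inductive Comp (K α : Type) : Type where
  | ret (a : α) : Comp K α
  | tick (next : Comp K α) : Comp K α
  | zero (next : K → Comp K α) : Comp K α
  | one (next : K → Comp K α) : Comp K α
  | add (x y : K) (next : K → Comp K α) : Comp K α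
  | sub (x y : K) (next : K → Comp K α) : Comp K α
  | mul (x y : K) (next : K → Comp K α) : Comp K α
  | lt (x y : K) (next : Bool → Comp K α) : Comp K α

namespace Comp

variable {K α β : Type}

protected def bind : Comp K α → (α → Comp K β) → Comp K β
  | ret a, f => f a
  | tick p, f => tick (p.bind f)
  | zero p, f => zero fun z => (p z).bind f
  | one p, f => one fun z => (p z).bind f
  | add x y p, f => add x y fun z => (p z).bind f
  | sub x y p, f => sub x y fun z => (p z).bind f
  | mul x y p, f => mul x y fun z => (p z).bind f
  | lt x y p, f => lt x y fun b => (p b).bind f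

instance : Monad (Comp K) where
  pure := ret
  bind := Comp.bind

/-- The result of a program. -/
def result [Ring K] [LinearOrder K] : Comp K α → α
  | ret a => a
  | tick p => p.result
  | zero p => (p 0).result
  | one p => (p 1).result
  | add x y p => (p (x + y)).result
  | sub x y p => (p (x - y)).result
  | mul x y p => (p (x * y)).result
  | lt x y p => (p (decide (x < y))).result

/-- The number of instructions that a program executes. -/
def steps [Ring K] [LinearOrder K] : Comp K α → ℕ
  | ret _ => 0
  | tick p => p.steps + 1
  | zero p => (p 0).steps + 1
  | one p => (p 1).steps + 1
  | add x y p => (p (x + y)).steps + 1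
  | sub x y p => (p (x - y)).steps + 1
  | mul x y p => (p (x * y)).steps + 1
  | lt x y p => (p (decide (x < y))).steps + 1

/-- Fill an array of length `m`; entry `i` is computed by `f i`. -/
def tabulate : (m : ℕ) → (Fin m → Comp K β) → Comp K (Fin m → β)
  | 0, _ => ret Fin.elim0
  | m + 1, f => tick do
      let b ← f 0
      let v ← tabulate m fun i => f i.succ
      ret (Fin.cons (α := fun _ => β) b v)

/-- Apply `step` successively `m` times, recording all values `t₀, …, t_m` in an array. -/
def history (step : β → Comp K β) (t₀ : β) : (m : ℕ) → Comp K (Fin (m + 1) → β)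
  | 0 => ret fun _ => t₀
  | m + 1 => tick do
      let v ← history step t₀ m
      let t ← step (v (Fin.last m))
      ret (Fin.snoc (α := fun _ => β) v t)

/-- Linear scan: replace the current index `best` by `j` whenever `v j` beats `v best`. -/
def scan {m : ℕ} (beats : β → β → Comp K Bool) (v : Fin m → β) :
    List (Fin m) → Fin m → Comp K (Fin m)
  | [], best => ret best
  | j :: js, best => tick do
      let b ← beats (v j) (v best)
      if b then scan beats v js j else scan beats v js best

/-! Polynomials are lists of coefficients, constant coefficient first. -/

def polyAdd : List K → List K → Comp K (List K)
  | [], q => ret q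
  | p, [] => ret p
  | a :: p, b :: q => add a b fun c => do
      let r ← polyAdd p q
      ret (c :: r)

def polySub : List K → List K → Comp K (List K)
  | p, [] => ret p
  | [], b :: q => zero fun z => sub z b fun c => do
      let r ← polySub [] q
      ret (c :: r)
  | a :: p, b :: q => sub a b fun c => do
      let r ← polySub p q
      ret (c :: r)

def polyScale (c : K) : List K → Comp K (List K)
  | [] => ret []
  | a :: p => mul c a fun b => do
      let r ← polyScale c p
      ret (b :: r)

/-- Schoolbook multiplication. -/
def polyMul : List K → List K → Comp K (List K)
  | [], _ => ret []
  | a :: p, q => do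
      let u ← polyScale a q
      let v ← polyMul p q
      zero fun z => polyAdd u (z :: v)

/-- Multiplication by the `m`-th power of the variable. -/
def polyShift : ℕ → List K → Comp K (List K)
  | 0, p => ret p
  | m + 1, p => zero fun z => do
      let r ← polyShift m p
      ret (z :: r)

/-- `1 - x ^ m`. -/
def oneSubPow (m : ℕ) : Comp K (List K) :=
  one fun o => do
    let q ← polyShift m [o]
    polySub [o] q

/-- Horner's scheme: the value `p(1)` and the quotient of `p` by `1 - x`. -/
def deflate : List K → Comp K (K × List K)
  | [] => zero fun z => ret (z, [])
  | c :: p => do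
      let (v, q) ← deflate p
      add c v fun w => zero fun z => sub z v fun e => ret (w, e :: q)

/-- Divide by `1 - x` as long as the value at `1` vanishes, and return the sign of the value at
`1` of the result (the first argument bounds the number of rounds; the zero polynomial gives
`0`). -/
def leadSign : List K → List K → Comp K SignType
  | [], _ => ret 0
  | _ :: fuel, p => do
      let (v, q) ← deflate p
      zero fun z => lt z v fun isPos => lt v z fun isNeg =>
        if isPos then ret 1 else if isNeg then ret (-1) else leadSign fuel q

end Comp

/-- A quotient of two polynomials in the discount factor, as two coefficient lists. -/
structure Quot2 (K : Type) where
  num : List K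
  den : List K

namespace Quot2

open Comp

variable {K : Type}

/-- Does `r₁ ≻ r₂` hold? Form the difference, remove the powers of `1 - x`, compare signs. -/
def gt (r₁ r₂ : Quot2 K) : Comp K Bool := do
  let u ← polyMul r₁.num r₂.den
  let v ← polyMul r₂.num r₁.den
  let η ← polySub u v
  let δ ← polyMul r₁.den r₂.den
  let e ← leadSign η η
  let f ← leadSign δ δ
  tick (ret (decide (e * f = 1)))

/-- `r + γ f`. -/
def backup (r : K) (f : Quot2 K) : Comp K (Quot2 K) := do
  let p ← polyScale r f.den
  zero fun z => do
    let q ← polyAdd p (z :: f.num)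
    ret ⟨q, f.den⟩

/-- `(f - γ ^ m g) / (1 - γ ^ m)`. -/
def ratio (m : ℕ) (f g : Quot2 K) : Comp K (Quot2 K) := do
  let u ← polyMul f.num g.den
  let v ← polyMul g.num f.den
  let w ← polyShift m v
  let p ← polySub u w
  let e ← oneSubPow m
  let h ← polyMul f.den g.den
  let q ← polyMul h e
  ret ⟨p, q⟩

def argmax {m : ℕ} [NeZero m] (v : Fin m → Quot2 K) : Comp K (Fin m) :=
  scan gt v (List.finRange m) 0

def argmin {m : ℕ} [NeZero m] (v : Fin m → Quot2 K) : Comp K (Fin m) :=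
  scan (fun x y => gt y x) v (List.finRange m) 0

end Quot2

namespace DMDP

open Comp

variable {K : Type} {n k : ℕ}

/-- One round of updates: for each state the best value of `r + γ f(s')` and a best action. -/
def sweep [NeZero k] (M : DMDP K n k) (f : Fin n → Quot2 K × Fin k) :
    Comp K (Fin n → Quot2 K × Fin k) :=
  tabulate n fun s => do
    let c ← tabulate k fun a => Quot2.backup (M.reward s a) (f (M.next s a)).1
    let b ← Quot2.argmax c
    ret (c b, b)

/-- The procedure DetMDP2-Blackwell as an arithmetic program. The tables `D` and `Y` hold the
pairs `(d_i(s), α_i(s))` and `(y_i(s), a_i(s))`. -/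
def detMDP2Blackwell [NeZero n] [NeZero k] (M : DMDP K n k) : Comp K (Fin n → Fin k) := do
  let D₀ ← tabulate n fun _ => one fun o => ret ((⟨[], [o]⟩ : Quot2 K), (0 : Fin k))
  let D ← history M.sweep D₀ n
  let Y₀ ← tabulate n fun s => do
    let c ← tabulate n fun i =>
      Quot2.ratio (n - i) (D (Fin.last n) s).1 (D i.castSucc s).1
    let i ← Quot2.argmin c
    ret (c i, (D (Fin.last n) s).2)
  let Y ← history M.sweep Y₀ (n - 1)
  tabulate n fun s => do
    let i ← Quot2.argmax fun i => (Y i s).1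
    ret (Y i s).2

end DMDP

/-! ### Values of deterministic MDPs for a fixed discount factor -/

/-! Fix a discount factor γ in (0,1), let V solve the optimality equation, and write Q(s,a) = r(s,a)
+ γV(s'(s,a)) ≤ V(s). Two bounds give optimality of the returned policy.

Upper bound: y_i(s) ≤ Q(s, a_i(s)). For i = 0, the n-step walk recorded in d_n(s) repeats a state.
Cutting out the cycle, of length c say, leaves a candidate for d_{n-c}(s), and comparing the two
bounds the entry n-c of the minimum (`exists_cycle_bound`). The bound by Q rather than by V is what
credits the recorded action. The rounds i > 0 preserve it.

Lower bound: V(s) ≤ y_m(s) for some m < n. Optimal actions lead from s into a cycle, some state x of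
which has V(x) ≤ y_0(x) (`exists_iterate_lower_bound`); backing up along the path carries this to s.

So V(s) ≤ max_i y_i(s) ≤ Q(s, π(s)): π uses only optimal actions, hence attains V
(`value_le_value_of_run`).

The μ-ordering is the pointwise ordering on a left neighbourhood of 1 (`MuGT.eventually_lt`,
`eventually_le_of_not_muGT`). A run involves finitely many comparisons, so they all hold numerically
on one interval to the left of 1, where the argument above applies to each γ.

For the running time, all coefficient lists have length O(n), so one comparison costs O(n²). The
2n-1 rounds compare O(nk) quotients each, and the two other selections O(n²), which gives O(n⁴k). -/

/-- A minimum principle for discounted dynamics. -/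
theorem nonneg_of_discount_mul_le {ι : Type*} [Finite ι] {γ : ℝ} (hγ0 : 0 ≤ γ) (hγ1 : γ < 1)
    {g : ι → ℝ} {σ : ι → ι} (h : ∀ s, γ * g (σ s) ≤ g s) (s : ι) : 0 ≤ g s := by
  have : Nonempty ι := ⟨s⟩
  obtain ⟨m, hm⟩ := Finite.exists_min g
  -- At a minimiser `m`, γ g(m) ≤ γ g(σ m) ≤ g(m), so (1-γ) g(m) ≥ 0.
  have h1 := mul_le_mul_of_nonneg_left (hm (σ m)) hγ0
  have h2 := h m
  have h3 : 0 ≤ g m := by nlinarith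
  exact h3.trans (hm s)

namespace DMDP

variable {n k : ℕ} (M : DMDP ℝ n k)

theorem transition_pow_mulVec (π : Fin n → Fin k) (t : ℕ) (f : Fin n → ℝ) (s : Fin n) :
    (M.toMDP.transition π ^ t).mulVec f s = f ((fun s => M.next s (π s))^[t] s) := by
  induction t generalizing s with
  | zero => simp
  | succ t ih =>
    rw [pow_succ', ← Matrix.mulVec_mulVec, Function.iterate_succ_apply, ← ih]
    simp [Matrix.mulVec, dotProduct, FiniteMDP.transition, toMDP]

theorem value_eq_tsum (π : Fin n → Fin k) (γ : ℝ) (s : Fin n) :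
    M.toMDP.value π γ s = ∑' t : ℕ, γ ^ t * M.reward ((fun s => M.next s (π s))^[t] s)
      (π ((fun s => M.next s (π s))^[t] s)) := by
  simp only [FiniteMDP.value, transition_pow_mulVec]
  rfl

theorem value_eq_backup (π : Fin n → Fin k) {γ : ℝ} (hγ0 : 0 ≤ γ) (hγ1 : γ < 1) (s : Fin n) :
    M.toMDP.value π γ s =
      M.reward s (π s) + γ * M.toMDP.value π γ (M.next s (π s)) := by
  have : Nonempty (Fin n) := ⟨s⟩
  obtain ⟨m, hm⟩ := Finite.exists_max fun s => |M.reward s (π s)|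
  have hsum : Summable fun t : ℕ => γ ^ t * M.reward ((fun s => M.next s (π s))^[t] s)
      (π ((fun s => M.next s (π s))^[t] s)) := by
    refine Summable.of_norm_bounded
      ((summable_geometric_of_lt_one hγ0 hγ1).mul_right |M.reward m (π m)|) fun t => ?_
    rw [norm_mul, Real.norm_of_nonneg (pow_nonneg hγ0 t), Real.norm_eq_abs]
    exact mul_le_mul_of_nonneg_left (hm _) (pow_nonneg hγ0 t)
  rw [value_eq_tsum, value_eq_tsum, hsum.tsum_eq_zero_add, ← tsum_mul_left]
  simp [pow_succ', mul_assoc]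

/-- The optimality equation has a solution. -/
theorem exists_bellman_solution [NeZero k] {γ : ℝ} (hγ0 : 0 ≤ γ) (hγ1 : γ < 1) :
    ∃ V : Fin n → ℝ, (∀ s a, M.reward s a + γ * V (M.next s a) ≤ V s) ∧
      ∀ s, ∃ a, V s = M.reward s a + γ * V (M.next s a) := by
  have hne : (Finset.univ : Finset (Fin k)).Nonempty := ⟨0, Finset.mem_univ _⟩
  let T : (Fin n → ℝ) → Fin n → ℝ := fun V s =>
    Finset.univ.sup' hne fun a => M.reward s a + γ * V (M.next s a)
  -- One-sided estimate; with `V` and `W` exchanged it makes `T` a γ-contraction in the sup norm,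
  -- and Banach's theorem gives the solution.
  have hle : ∀ V W s, T V s ≤ T W s + γ * dist V W := fun V W s => by
    refine Finset.sup'_le _ _ fun a _ => ?_
    have h1 : M.reward s a + γ * W (M.next s a) ≤ T W s :=
      Finset.le_sup' (fun a => M.reward s a + γ * W (M.next s a)) (Finset.mem_univ a)
    have h2 : V (M.next s a) - W (M.next s a) ≤ dist V W :=
      (le_abs_self _).trans (dist_le_pi_dist V W (M.next s a))
    nlinarith
  have hT : ContractingWith ⟨γ, hγ0⟩ T := by
    refine ⟨hγ1, LipschitzWith.of_dist_le_mul fun V W => ?_⟩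
    refine (dist_pi_le_iff (by positivity)).2 fun s => ?_
    rw [Real.dist_eq, abs_le]
    have h1 := hle V W s
    have h2 := hle W V s
    rw [dist_comm] at h2
    change -(γ * dist V W) ≤ T V s - T W s ∧ T V s - T W s ≤ γ * dist V W
    constructor <;> linarith
  have hfix : T (hT.fixedPoint T) = hT.fixedPoint T := hT.fixedPoint_isFixedPt
  refine ⟨hT.fixedPoint T, fun s a => ?_, fun s => ?_⟩
  · conv_rhs => rw [← hfix]
    exact Finset.le_sup' (fun a => M.reward s a + γ * hT.fixedPoint T (M.next s a))
      (Finset.mem_univ a)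
  · obtain ⟨a, -, ha⟩ := Finset.exists_mem_eq_sup' hne
      fun a => M.reward s a + γ * hT.fixedPoint T (M.next s a)
    exact ⟨a, by rw [← ha]; exact (congrFun hfix s).symm⟩

variable {M} {γ : ℝ} {V : Fin n → ℝ}

/-- The difference of V and the value of π satisfies the minimum principle along the successor map
of π. The next lemma is the same argument with the signs reversed. -/
theorem value_le_of_bellman (hγ0 : 0 ≤ γ) (hγ1 : γ < 1)
    (hV : ∀ s a, M.reward s a + γ * V (M.next s a) ≤ V s) (π : Fin n → Fin k) (s : Fin n) :
    M.toMDP.value π γ s ≤ V s := by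
  refine sub_nonneg.1 (nonneg_of_discount_mul_le (g := fun s => V s - M.toMDP.value π γ s)
    (σ := fun s => M.next s (π s)) hγ0 hγ1 (fun s => ?_) s)
  have h1 := M.value_eq_backup π hγ0 hγ1 s
  have h2 := hV s (π s)
  linarith

theorem le_value_of_conserving (hγ0 : 0 ≤ γ) (hγ1 : γ < 1) {π : Fin n → Fin k}
    (hπ : ∀ s, V s ≤ M.reward s (π s) + γ * V (M.next s (π s))) (s : Fin n) :
    V s ≤ M.toMDP.value π γ s := by
  refine sub_nonneg.1 (nonneg_of_discount_mul_le (g := fun s => M.toMDP.value π γ s - V s)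
    (σ := fun s => M.next s (π s)) hγ0 hγ1 (fun s => ?_) s)
  have h1 := M.value_eq_backup π hγ0 hγ1 s
  have h2 := hπ s
  linarith

/-! ### The recursion for a fixed discount factor -/

theorem exists_lt_le_eq {n : ℕ} (w : ℕ → Fin n) : ∃ p q, p < q ∧ q ≤ n ∧ w p = w q := by
  obtain ⟨x, y, hne, hxy⟩ := Fintype.exists_ne_map_eq_of_card_lt
    (fun i : Fin (n + 1) => w i) (by simp)
  rcases lt_or_gt_of_ne hne with h | h
  · exact ⟨x, y, h, Nat.lt_succ_iff.1 y.2, hxy⟩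
  · exact ⟨y, x, h, Nat.lt_succ_iff.1 x.2, hxy.symm⟩

/-- Cutting a cycle out of an optimal walk of `n` steps. -/
theorem exists_cycle_bound (hγ0 : 0 ≤ γ) (hγ1 : γ < 1)
    (hV : ∀ s a, M.reward s a + γ * V (M.next s a) ≤ V s)
    {d : ℕ → Fin n → ℝ} {α : ℕ → Fin n → Fin k}
    (hd : ∀ i < n, ∀ s b, M.reward s b + γ * d i (M.next s b) ≤ d (i + 1) s)
    (hα : ∀ i < n, ∀ s,
      d (i + 1) s = M.reward s (α (i + 1) s) + γ * d i (M.next s (α (i + 1) s))) (s : Fin n) :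
    ∃ i < n, d n s - γ ^ (n - i) * d i s ≤
      (1 - γ ^ (n - i)) * (M.reward s (α n s) + γ * V (M.next s (α n s))) := by
  -- At time `j` there remain n-j steps, hence the action `α (n - j)`. Below, `ρ j` is minus the
  -- loss against V caused by that action.
  let w : ℕ → Fin n := fun j => Nat.rec s (fun j x => M.next x (α (n - j) x)) j
  have hw : ∀ j, w (j + 1) = M.next (w j) (α (n - j) (w j)) := fun j => rfl
  let ρ : ℕ → ℝ := fun j =>
    M.reward (w j) (α (n - j) (w j)) + γ * V (w (j + 1)) - V (w j)
  have hρ : ∀ j, ρ j ≤ 0 := fun j => sub_nonpos.2 (hV _ _)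
  have hstep : ∀ j < n, d (n - j) (w j) - V (w j) =
      ρ j + γ * (d (n - (j + 1)) (w (j + 1)) - V (w (j + 1))) := fun j hj => by
    have h := hα (n - (j + 1)) (by omega) (w j)
    rw [show n - (j + 1) + 1 = n - j by omega, ← hw] at h
    rw [h]; ring
  obtain ⟨p, q, hpq, hqn, heq⟩ := exists_lt_le_eq w
  obtain ⟨m, rfl⟩ := Nat.exists_eq_add_of_lt hpq
  set c := γ ^ (m + 1) with hc
  have hc0 : 0 ≤ c := pow_nonneg hγ0 _
  have hc1 : c ≤ 1 := pow_le_one₀ hγ0 hγ1.le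
  have hwalk : ∀ l j, j + l ≤ n → d (n - j) (w j) - V (w j) ≤
      γ ^ l * (d (n - (j + l)) (w (j + l)) - V (w (j + l))) := by
    intro l
    induction l with
    | zero => intro j _; simp
    | succ l ih =>
      intro j hj
      have h1 := ih (j + 1) (by omega)
      rw [show j + 1 + l = j + (l + 1) by ring] at h1
      have h2 := mul_le_mul_of_nonneg_left h1 hγ0
      rw [hstep j (by omega), pow_succ']
      have := hρ j
      linarith
  -- Backwards along the walk, from the repeated state `w p` to `s = w 0`. At `p` the cycle is
  -- traversed once. Each step back splits ρ as (1-c)ρ + cρ, drops the earlier (1-c)ρ ≤ 0, and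
  -- absorbs cρ by using the recorded action as a candidate in the recursion with m+1 fewer steps.
  have hback : ∀ l ≤ p, d (n - (p - l)) (w (p - l)) - V (w (p - l)) ≤
      (1 - c) * ρ (p - l) +
        c * (d (n - (p - l) - (m + 1)) (w (p - l)) - V (w (p - l))) := by
    intro l
    induction l with
    | zero =>
      intro _
      have h1 := hwalk m (p + 1) (by omega)
      rw [show p + 1 + m = p + m + 1 by ring, ← heq] at h1
      have h2 := mul_le_mul_of_nonneg_left h1 hγ0
      simp only [Nat.sub_zero]
      rw [hstep p (by omega), show n - p - (m + 1) = n - (p + m + 1) by omega, hc, pow_succ']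
      rw [hc, pow_succ'] at hc0
      have := mul_nonpos_of_nonneg_of_nonpos hc0 (hρ p)
      linarith
    | succ l ih =>
      intro hl
      obtain ⟨j, hj⟩ : ∃ j, p - l = j + 1 := ⟨p - l - 1, by omega⟩
      have hj' : p - (l + 1) = j := by omega
      have h1 := ih (by omega)
      rw [hj] at h1
      rw [hj', hstep j (by omega)]
      have h2 := hd (n - (j + 1) - (m + 1)) (by omega) (w j) (α (n - j) (w j))
      rw [show n - (j + 1) - (m + 1) + 1 = n - j - (m + 1) by omega, ← hw] at h2
      have h3 := mul_nonpos_of_nonneg_of_nonpos (sub_nonneg.2 hc1) (hρ (j + 1))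
      have h4 : γ * (d (n - (j + 1)) (w (j + 1)) - V (w (j + 1))) ≤
          γ * (c * (d (n - (j + 1) - (m + 1)) (w (j + 1)) - V (w (j + 1)))) :=
        mul_le_mul_of_nonneg_left (by linarith) hγ0
      have h5 : c * (ρ j + γ * (d (n - (j + 1) - (m + 1)) (w (j + 1)) - V (w (j + 1)))) ≤
          c * (d (n - j - (m + 1)) (w j) - V (w j)) := by
        refine mul_le_mul_of_nonneg_left ?_ hc0
        simp only [ρ]
        linarith
      linarith
  have h0 := hback p le_rfl
  simp only [Nat.sub_self, Nat.sub_zero] at h0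
  refine ⟨n - (m + 1), by omega, ?_⟩
  rw [show n - (n - (m + 1)) = m + 1 by omega, ← hc]
  simp only [ρ, Nat.sub_zero, hw] at h0
  change d n s - V s ≤ (1 - c) * (M.reward s (α n s) + γ * V (M.next s (α n s)) - V s) +
    c * (d (n - (m + 1)) s - V s) at h0
  linarith

/-- On a cycle of optimal actions, the bound given by some state is the optimal value. -/
theorem exists_iterate_lower_bound (hγ0 : 0 < γ) {d : ℕ → Fin n → ℝ} {σ : Fin n → Fin n}
    (hσ : ∀ i < n, ∀ s, γ * (d i (σ s) - V (σ s)) ≤ d (i + 1) s - V s) (s : Fin n) :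
    ∃ m < n, ∀ i < n, γ ^ (n - i) * (d i (σ^[m] s) - V (σ^[m] s)) ≤
      d n (σ^[m] s) - V (σ^[m] s) := by
  obtain ⟨p, q, hpq, hqn, heq⟩ := exists_lt_le_eq fun j => σ^[j] s
  have hn : 0 < n := by omega
  have hL : 0 < q - p := by omega
  have hper : Function.IsPeriodicPt σ (q - p) (σ^[p] s) := by
    rw [Function.IsPeriodicPt, Function.IsFixedPt, ← Function.iterate_add_apply,
      Nat.sub_add_cancel hpq.le]
    exact heq.symm
  -- After rescaling by γ^i, following σ for l steps while i drops by l never increases `f`; see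
  -- `hf`.
  let f : ℕ → Fin n → ℝ := fun i x => (d i x - V x) / γ ^ i
  have : Nonempty (Fin n × Fin (q - p)) := ⟨⟨⟨0, hn⟩, ⟨0, hL⟩⟩⟩
  obtain ⟨⟨i, j⟩, hmax⟩ := Finite.exists_max fun x : Fin n × Fin (q - p) =>
    f x.1 (σ^[x.2] (σ^[p] s))
  have hf : ∀ l i, i + l ≤ n → ∀ x, f i (σ^[l] x) ≤ f (i + l) x := by
    intro l
    induction l with
    | zero => intro i _ x; simp
    | succ l ih =>
      intro i hi x
      rw [Function.iterate_succ_apply]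
      refine (ih i (by omega) _).trans ?_
      rw [← add_assoc]
      simp only [f]
      rw [div_le_div_iff₀ (by positivity) (by positivity)]
      have := mul_le_mul_of_nonneg_right (hσ (i + l) (by omega) x) (pow_nonneg hγ0.le (i + l))
      rw [pow_succ]
      linarith
  -- The cycle state from which n-i steps lead to the maximising state. Then `f n` there is at least
  -- the maximum of all `f i'` on the cycle. The multiple n(q-p) of the period only keeps the
  -- subtraction from truncating.
  set t := (j + n * (q - p) - (n - i)) % (q - p) with ht
  have htL : t < q - p := Nat.mod_lt _ hL
  -- t < q-p and q ≤ n give t+p < n, so the available rounds suffice to return to `s`.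
  refine ⟨t + p, by omega, fun i' hi' => ?_⟩
  rw [Function.iterate_add_apply]
  have hnL : n ≤ n * (q - p) := Nat.le_mul_of_pos_right n hL
  have hback : σ^[n - i] (σ^[t] (σ^[p] s)) = σ^[j] (σ^[p] s) := by
    rw [ht, hper.iterate_mod_apply, ← Function.iterate_add_apply,
      show (n - i : ℕ) + (j + n * (q - p) - (n - i)) = j + n * (q - p) by omega,
      ← hper.iterate_mod_apply, Nat.add_mul_mod_self_right, hper.iterate_mod_apply]
  have h1 := hf (n - i) i (by omega) (σ^[t] (σ^[p] s))
  rw [hback, show (i : ℕ) + (n - i) = n by omega] at h1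
  have h2 := (hmax ⟨⟨i', hi'⟩, ⟨t, htL⟩⟩).trans h1
  simp only [f] at h2
  rw [div_le_div_iff₀ (by positivity) (by positivity)] at h2
  have h3 : γ ^ n = γ ^ (n - i') * γ ^ i' := by rw [← pow_add]; congr 1; omega
  rw [h3, ← mul_assoc] at h2
  have := le_of_mul_le_mul_right h2 (pow_pos hγ0 i')
  linarith

/-- The recursion of the procedure, evaluated at a discount factor, yields an optimal policy. -/
theorem value_le_value_of_run [NeZero k] (hγ0 : 0 < γ) (hγ1 : γ < 1)
    {d y : ℕ → Fin n → ℝ} {α a : ℕ → Fin n → Fin k} {ib : Fin n → ℕ} {π : Fin n → Fin k}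
    (hd : ∀ i < n, ∀ s b, M.reward s b + γ * d i (M.next s b) ≤ d (i + 1) s)
    (hα : ∀ i < n, ∀ s,
      d (i + 1) s = M.reward s (α (i + 1) s) + γ * d i (M.next s (α (i + 1) s)))
    (hy0 : ∀ s, ∀ i < n, (1 - γ ^ (n - i)) * y 0 s ≤ d n s - γ ^ (n - i) * d i s)
    (hy0' : ∀ s, ∃ i < n, (1 - γ ^ (n - i)) * y 0 s = d n s - γ ^ (n - i) * d i s)
    (ha0 : ∀ s, a 0 s = α n s)
    (hy : ∀ i, i + 1 < n → ∀ s b, M.reward s b + γ * y i (M.next s b) ≤ y (i + 1) s)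
    (ha : ∀ i, i + 1 < n → ∀ s,
      y (i + 1) s = M.reward s (a (i + 1) s) + γ * y i (M.next s (a (i + 1) s)))
    (hib : ∀ s, ib s < n) (hib' : ∀ s, ∀ i < n, y i s ≤ y (ib s) s)
    (hπ : ∀ s, π s = a (ib s) s) (π' : Fin n → Fin k) (s : Fin n) :
    M.toMDP.value π' γ s ≤ M.toMDP.value π γ s := by
  obtain ⟨V, hV, hV'⟩ := M.exists_bellman_solution hγ0.le hγ1
  choose b hb using hV'
  have hpow : ∀ i < n, 0 < 1 - γ ^ (n - i) := fun i hi =>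
    sub_pos.2 (pow_lt_one₀ hγ0.le hγ1 (by omega))
  have hupper : ∀ i < n, ∀ s, y i s ≤ M.reward s (a i s) + γ * V (M.next s (a i s)) := by
    intro i
    induction i with
    | zero =>
      intro _ s
      obtain ⟨i, hi, h⟩ := exists_cycle_bound hγ0.le hγ1 hV hd hα s
      rw [ha0]
      exact le_of_mul_le_mul_left ((hy0 s i hi).trans h) (hpow i hi)
    | succ i ih =>
      intro hi s
      rw [ha i hi]
      gcongr
      exact (ih (by omega) _).trans (hV _ _)
  have hlower : ∀ s, ∃ m < n, V s ≤ y m s := by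
    intro s
    obtain ⟨m, hm, h⟩ := exists_iterate_lower_bound (V := V) (d := d)
      (σ := fun s => M.next s (b s)) hγ0 (fun i hi s => by
        have h1 := hd i hi s (b s)
        have h2 := hb s
        linarith) s
    refine ⟨m, hm, ?_⟩
    have hbase : V ((fun s => M.next s (b s))^[m] s) ≤ y 0 ((fun s => M.next s (b s))^[m] s) := by
      obtain ⟨i, hi, hyi⟩ := hy0' ((fun s => M.next s (b s))^[m] s)
      have := h i hi
      refine le_of_mul_le_mul_left ?_ (hpow i hi)
      linarith
    clear h
    induction m generalizing s with
    | zero => exact hbase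
    | succ m ih =>
      have h1 := ih (M.next s (b s)) (by omega) hbase
      have h2 := mul_le_mul_of_nonneg_left h1 hγ0.le
      have h3 := hy m hm s (b s)
      have h4 := hb s
      linarith
  refine (value_le_of_bellman hγ0.le hγ1 hV π' s).trans
    (le_value_of_conserving hγ0.le hγ1 (fun s => ?_) s)
  obtain ⟨m, hm, h⟩ := hlower s
  rw [hπ]
  exact (h.trans (hib' s m hm)).trans (hupper _ (hib s) s)

end DMDP

/-! ### Rational functions to the left of `1` -/

open Filter Topology

theorem Polynomial.exists_eq_one_sub_X_pow_mul {p : ℝ[X]} (hp : p ≠ 0) :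
    ∃ (c : ℕ) (η : ℝ[X]), η.eval 1 ≠ 0 ∧ p = (1 - Polynomial.X) ^ c * η := by
  obtain ⟨g, hg, hdvd⟩ := p.exists_eq_pow_rootMultiplicity_mul_and_not_dvd hp 1
  -- The sign converts powers of X-1 into powers of 1-X.
  refine ⟨p.rootMultiplicity 1, (-1) ^ p.rootMultiplicity 1 * g, ?_, ?_⟩
  · rw [Polynomial.dvd_iff_isRoot, Polynomial.IsRoot] at hdvd
    simp [hdvd]
  · conv_lhs => rw [hg]
    rw [← mul_assoc, ← mul_pow]
    simp

theorem Polynomial.eventually_eval_pos {η : ℝ[X]} (h : 0 < η.eval 1) :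
    ∀ᶠ γ in 𝓝[<] (1 : ℝ), 0 < η.eval γ :=
  (η.continuous.continuousAt.tendsto.mono_left nhdsWithin_le_nhds).eventually (lt_mem_nhds h)

theorem Polynomial.eventually_eval_ne_zero {p : ℝ[X]} (hp : p ≠ 0) :
    ∀ᶠ γ in 𝓝[<] (1 : ℝ), p.eval γ ≠ 0 := by
  obtain ⟨c, η, hη, rfl⟩ := exists_eq_one_sub_X_pow_mul hp
  have h1 : ∀ᶠ γ in 𝓝[<] (1 : ℝ), η.eval γ ≠ 0 :=
    (η.continuous.continuousAt.tendsto.mono_left nhdsWithin_le_nhds).eventually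
      (isOpen_ne.mem_nhds hη)
  filter_upwards [h1, self_mem_nhdsWithin] with γ h hγ
  have : 1 - γ ≠ 0 := (sub_pos.2 hγ).ne'
  simp [h, this]

namespace RatFunc

/-- The value of a real rational function at a real number. -/
noncomputable def realEval (γ : ℝ) (r : RatFunc ℝ) : ℝ :=
  r.eval (RingHom.id ℝ) γ

/-- Evaluation takes the junk value 0 at poles, so it is compatible with the field operations only
away from them; poles do not accumulate at 1. -/
theorem eventually_denom_ne_zero (r : RatFunc ℝ) :
    ∀ᶠ γ in 𝓝[<] (1 : ℝ), r.denom.eval₂ (RingHom.id ℝ) γ ≠ 0 :=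
  Polynomial.eventually_eval_ne_zero r.denom_ne_zero

theorem realEval_algebraMap (γ : ℝ) (p : ℝ[X]) :
    realEval γ (algebraMap ℝ[X] (RatFunc ℝ) p) = p.eval γ := by
  simp [realEval, Polynomial.eval₂_id]

theorem eventually_realEval_add (r₁ r₂ : RatFunc ℝ) :
    ∀ᶠ γ in 𝓝[<] (1 : ℝ), realEval γ (r₁ + r₂) = realEval γ r₁ + realEval γ r₂ := by
  filter_upwards [r₁.eventually_denom_ne_zero, r₂.eventually_denom_ne_zero] with γ h1 h2
  exact eval_add _ _ h1 h2

theorem eventually_realEval_mul (r₁ r₂ : RatFunc ℝ) :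
    ∀ᶠ γ in 𝓝[<] (1 : ℝ), realEval γ (r₁ * r₂) = realEval γ r₁ * realEval γ r₂ := by
  filter_upwards [r₁.eventually_denom_ne_zero, r₂.eventually_denom_ne_zero] with γ h1 h2
  exact eval_mul _ _ h1 h2

theorem eventually_realEval_sub (r₁ r₂ : RatFunc ℝ) :
    ∀ᶠ γ in 𝓝[<] (1 : ℝ), realEval γ (r₁ - r₂) = realEval γ r₁ - realEval γ r₂ := by
  filter_upwards [eventually_realEval_add (r₁ - r₂) r₂] with γ h
  rw [sub_add_cancel] at h
  linarith

theorem eventually_realEval_div (p : ℝ[X]) {q : ℝ[X]} (hq : q ≠ 0) :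
    ∀ᶠ γ in 𝓝[<] (1 : ℝ), realEval γ (algebraMap ℝ[X] (RatFunc ℝ) p / algebraMap _ _ q) =
      p.eval γ / q.eval γ := by
  filter_upwards [eventually_realEval_mul (algebraMap ℝ[X] (RatFunc ℝ) p / algebraMap _ _ q)
    (algebraMap _ _ q), Polynomial.eventually_eval_ne_zero hq] with γ h hγ
  rw [div_mul_cancel₀ _ (algebraMap_ne_zero hq), realEval_algebraMap, realEval_algebraMap] at h
  rw [h, mul_div_cancel_right₀ _ hγ]

end RatFunc

open RatFunc

/-- Powers of 1-γ are positive for γ < 1, so near 1 the sign of the difference is that of η(1)δ(1).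
Asymmetry and transitivity of the ordering follow by evaluating at a common γ. -/
theorem MuGT.eventually_lt {r₁ r₂ : RatFunc ℝ} (h : MuGT r₁ r₂) :
    ∀ᶠ γ in 𝓝[<] (1 : ℝ), realEval γ r₂ < realEval γ r₁ := by
  obtain ⟨c₁, c₂, η, δ, hpos, heq⟩ := h
  have hX : (1 - Polynomial.X : ℝ[X]) ≠ 0 := fun h => by
    simpa using congrArg (Polynomial.eval 0) h
  have hδ : δ ≠ 0 := fun h => by simp [h] at hpos
  rw [← Polynomial.eval_mul] at hpos
  filter_upwards [eventually_realEval_sub r₁ r₂,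
    eventually_realEval_div ((1 - Polynomial.X) ^ c₁ * η) (mul_ne_zero (pow_ne_zero c₂ hX) hδ),
    Polynomial.eventually_eval_pos hpos, self_mem_nhdsWithin] with γ h1 h2 h3 hγ
  have hγ' : 0 < 1 - γ := sub_pos.2 hγ
  rw [← heq, h1] at h2
  refine sub_pos.1 (h2 ▸ ?_)
  simp only [Polynomial.eval_mul, Polynomial.eval_pow, Polynomial.eval_sub, Polynomial.eval_one,
    Polynomial.eval_X] at h3 ⊢
  rw [mul_div_mul_comm]
  refine mul_pos (by positivity) ?_
  rcases pos_and_pos_or_neg_and_neg_of_mul_pos h3 with h | h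
  · exact div_pos h.1 h.2
  · exact div_pos_of_neg_of_neg h.1 h.2

theorem MuGT.asymm {r₁ r₂ : RatFunc ℝ} (h : MuGT r₁ r₂) : ¬ MuGT r₂ r₁ := fun h' => by
  obtain ⟨γ, h1, h2⟩ := (h.eventually_lt.and h'.eventually_lt).exists
  exact lt_asymm h1 h2

theorem not_muGT_self (r : RatFunc ℝ) : ¬ MuGT r r := fun h => h.asymm h

theorem muGT_of_sub_eq {r₁ r₂ : RatFunc ℝ} {c₁ c₂ : ℕ} {η δ : ℝ[X]}
    (hneg : η.eval 1 * δ.eval 1 < 0)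
    (h : r₁ - r₂ = algebraMap ℝ[X] (RatFunc ℝ) ((1 - Polynomial.X) ^ c₁ * η) /
      algebraMap ℝ[X] (RatFunc ℝ) ((1 - Polynomial.X) ^ c₂ * δ)) : MuGT r₂ r₁ := by
  refine ⟨c₁, c₂, -η, δ, by simpa using hneg, ?_⟩
  rw [← neg_sub, h, mul_neg, map_neg, neg_div]

theorem eq_or_muGT_or_muGT (r₁ r₂ : RatFunc ℝ) : r₁ = r₂ ∨ MuGT r₁ r₂ ∨ MuGT r₂ r₁ := by
  by_cases h : r₁ - r₂ = 0
  · exact Or.inl (sub_eq_zero.1 h)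
  right
  obtain ⟨c₁, η, hη, hnum⟩ := Polynomial.exists_eq_one_sub_X_pow_mul (RatFunc.num_ne_zero h)
  obtain ⟨c₂, δ, hδ, hden⟩ := Polynomial.exists_eq_one_sub_X_pow_mul (r₁ - r₂).denom_ne_zero
  have heq := (RatFunc.num_div_denom (r₁ - r₂)).symm
  rw [hnum, hden] at heq
  rcases lt_or_gt_of_ne (mul_ne_zero hη hδ) with hs | hs
  · exact Or.inr (muGT_of_sub_eq hs heq)
  · exact Or.inl ⟨c₁, c₂, η, δ, hs, heq⟩

theorem eventually_le_of_not_muGT {r₁ r₂ : RatFunc ℝ} (h : ¬ MuGT r₁ r₂) :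
    ∀ᶠ γ in 𝓝[<] (1 : ℝ), realEval γ r₁ ≤ realEval γ r₂ := by
  rcases eq_or_muGT_or_muGT r₁ r₂ with rfl | h' | h'
  · simp
  · exact absurd h' h
  · exact h'.eventually_lt.mono fun γ => le_of_lt

theorem not_muGT_trans {r₁ r₂ r₃ : RatFunc ℝ} (h₁ : ¬ MuGT r₁ r₂) (h₂ : ¬ MuGT r₂ r₃) :
    ¬ MuGT r₁ r₃ := fun h => by
  obtain ⟨γ, h1, h2, h3⟩ := ((eventually_le_of_not_muGT h₁).and
    ((eventually_le_of_not_muGT h₂).and h.eventually_lt)).exists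
  exact (h1.trans h2).not_gt h3

/-! ### Transfer from rational functions to discount factors near 1 -/

namespace DMDP

variable {n k : ℕ} {M : DMDP ℝ n k}

theorem eventually_realEval_backup (f : Fin n → RatFunc ℝ) (s : Fin n) (a : Fin k) :
    ∀ᶠ γ in 𝓝[<] (1 : ℝ), realEval γ (M.backup f s a) =
      M.reward s a + γ * realEval γ (f (M.next s a)) := by
  filter_upwards [eventually_realEval_add (RatFunc.C (M.reward s a))
    (RatFunc.X * f (M.next s a)), eventually_realEval_mul RatFunc.X (f (M.next s a))] with γ h1 h2
  rw [backup, h1, h2]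
  simp [realEval]

theorem eventually_realEval_ratio {m : ℕ} (hm : m ≠ 0) (f g : RatFunc ℝ) :
    ∀ᶠ γ in 𝓝[<] (1 : ℝ), (1 - γ ^ m) *
      realEval γ ((f - RatFunc.X ^ m * g) / (1 - RatFunc.X ^ m)) =
        realEval γ f - γ ^ m * realEval γ g := by
  have hX : (RatFunc.X : RatFunc ℝ) ^ m = algebraMap ℝ[X] _ (Polynomial.X ^ m) := by simp
  have h1X : (1 : RatFunc ℝ) - RatFunc.X ^ m = algebraMap ℝ[X] _ (1 - Polynomial.X ^ m) := by
    simp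
  have hne : (1 : RatFunc ℝ) - RatFunc.X ^ m ≠ 0 := by
    rw [h1X]
    refine algebraMap_ne_zero fun h => ?_
    simpa [hm] using congrArg (Polynomial.eval 0) h
  filter_upwards [eventually_realEval_sub f (RatFunc.X ^ m * g),
    eventually_realEval_mul (RatFunc.X ^ m) g,
    eventually_realEval_mul (1 - RatFunc.X ^ m)
      ((f - RatFunc.X ^ m * g) / (1 - RatFunc.X ^ m))] with γ h1 h2 h3
  have e1 : realEval γ (RatFunc.X ^ m) = γ ^ m := by
    rw [hX, realEval_algebraMap]; simp
  have e2 : realEval γ (1 - RatFunc.X ^ m) = 1 - γ ^ m := by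
    rw [h1X, realEval_algebraMap]; simp
  rw [mul_div_cancel₀ _ hne, h1, h2, e1, e2] at h3
  exact h3.symm

/-- Every policy that the procedure can return is Blackwell optimal. -/
theorem IsDetMDP2Output.isBlackwellOptimal [NeZero k] {π : Fin n → Fin k}
    (h : M.IsDetMDP2Output π) : M.toMDP.IsBlackwellOptimal π := by
  obtain ⟨d, y, α, a, ib, H⟩ := h
  choose j hj hj' using H.y_zero
  have hd0 : ∀ᶠ γ in 𝓝[<] (1 : ℝ), ∀ i ∈ Set.Iio n, ∀ s b,
      realEval γ (M.backup (d i) s b) = M.reward s b + γ * realEval γ (d i (M.next s b)) := by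
    simp only [eventually_all_finite (Set.finite_Iio n), eventually_all]
    exact fun i _ s b => eventually_realEval_backup _ _ _
  have hy0 : ∀ᶠ γ in 𝓝[<] (1 : ℝ), ∀ i ∈ Set.Iio n, ∀ s b,
      realEval γ (M.backup (y i) s b) = M.reward s b + γ * realEval γ (y i (M.next s b)) := by
    simp only [eventually_all_finite (Set.finite_Iio n), eventually_all]
    exact fun i _ s b => eventually_realEval_backup _ _ _
  have hd : ∀ᶠ γ in 𝓝[<] (1 : ℝ), ∀ i ∈ Set.Iio n, ∀ s b,
      realEval γ (M.backup (d i) s b) ≤ realEval γ (d (i + 1) s) := by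
    simp only [eventually_all_finite (Set.finite_Iio n), eventually_all]
    intro i hi s b
    rw [H.d_succ i hi]
    exact eventually_le_of_not_muGT ((H.alpha_argmax i hi s).2 b trivial)
  have hy : ∀ᶠ γ in 𝓝[<] (1 : ℝ), ∀ i ∈ Set.Iio (n - 1), ∀ s b,
      realEval γ (M.backup (y i) s b) ≤ realEval γ (y (i + 1) s) := by
    simp only [eventually_all_finite (Set.finite_Iio (n - 1)), eventually_all]
    intro i hi s b
    have hi' : i + 1 < n := by have := Set.mem_Iio.1 hi; omega
    rw [H.y_succ i hi']
    exact eventually_le_of_not_muGT ((H.a_argmax i hi' s).2 b trivial)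
  have hib : ∀ᶠ γ in 𝓝[<] (1 : ℝ), ∀ i ∈ Set.Iio n, ∀ s,
      realEval γ (y i s) ≤ realEval γ (y (ib s) s) := by
    simp only [eventually_all_finite (Set.finite_Iio n), eventually_all]
    exact fun i hi s => eventually_le_of_not_muGT ((H.ib_argmax s).2 i hi)
  have hratio : ∀ᶠ γ in 𝓝[<] (1 : ℝ), ∀ i ∈ Set.Iio n, ∀ s, (1 - γ ^ (n - i)) *
      realEval γ ((d n s - RatFunc.X ^ (n - i) * d i s) / (1 - RatFunc.X ^ (n - i))) =
        realEval γ (d n s) - γ ^ (n - i) * realEval γ (d i s) := by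
    simp only [eventually_all_finite (Set.finite_Iio n), eventually_all]
    exact fun i hi s => eventually_realEval_ratio (by have := Set.mem_Iio.1 hi; omega) _ _
  have hmin : ∀ᶠ γ in 𝓝[<] (1 : ℝ), ∀ i ∈ Set.Iio n, ∀ s, realEval γ (y 0 s) ≤
      realEval γ ((d n s - RatFunc.X ^ (n - i) * d i s) / (1 - RatFunc.X ^ (n - i))) := by
    simp only [eventually_all_finite (Set.finite_Iio n), eventually_all]
    intro i hi s
    rw [hj']
    exact eventually_le_of_not_muGT ((hj s).2 i hi)
  have hpos : ∀ᶠ γ in 𝓝[<] (1 : ℝ), 0 < γ := nhdsWithin_le_nhds (lt_mem_nhds one_pos)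
  -- The competitor π' is quantified after γ: its value need not be compared as a rational function.
  have hall : ∀ᶠ γ in 𝓝[<] (1 : ℝ), ∀ (π' : Fin n → Fin k) (s : Fin n),
      M.toMDP.value π' γ s ≤ M.toMDP.value π γ s := by
    filter_upwards [hd0, hy0, hd, hy, hib, hratio, hmin, hpos, self_mem_nhdsWithin] with
      γ hd0 hy0 hd hy hib hratio hmin hγ0 hγ1
    refine value_le_value_of_run (d := fun i s => realEval γ (d i s))
      (y := fun i s => realEval γ (y i s)) (α := α) (a := a) (ib := ib) hγ0 hγ1
      (fun i hi s b => hd0 i hi s b ▸ hd i hi s b)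
      (fun i hi s => ?_) (fun s i hi => ?_) (fun s => ⟨j s, (hj s).1, ?_⟩) H.a_zero
      (fun i hi s b => hy0 i (Set.mem_Iio.2 (by omega)) s b ▸ hy i (Set.mem_Iio.2 (by omega)) s b)
      (fun i hi s => ?_) (fun s => (H.ib_argmax s).1) (fun s i hi => hib i hi s) H.output
    · rw [← hd0 i hi, ← H.d_succ i hi]
    · have hpow : γ ^ (n - i) ≤ 1 := pow_le_one₀ hγ0.le (le_of_lt hγ1)
      rw [← hratio i hi]
      exact mul_le_mul_of_nonneg_left (hmin i hi s) (sub_nonneg.2 hpow)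
    · rw [← hratio _ (hj s).1, hj']
    · rw [← hy0 i (Set.mem_Iio.2 (by omega)), ← H.y_succ i hi]
  -- The set contains some [l,1); the maximum with 0 makes the threshold nonnegative.
  obtain ⟨l, hl, h⟩ := (mem_nhdsLT_iff_exists_Ico_subset).1 hall
  exact ⟨max l 0, le_max_right _ _, max_lt hl one_pos,
    fun γ h1 h2 => h ⟨(le_max_left _ _).trans h1, h2⟩⟩

end DMDP

/-! ### Results of arithmetic programs -/

namespace Comp

section Result

variable {K α β : Type} [Ring K] [LinearOrder K]

@[simp] theorem result_bind (p : Comp K α) (f : α → Comp K β) :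
    (p >>= f).result = (f p.result).result := by
  change (p.bind f).result = _
  induction p with
  | ret a => rfl
  | tick p ih => exact ih
  | zero p ih => exact ih _
  | one p ih => exact ih _
  | add x y p ih => exact ih _
  | sub x y p ih => exact ih _
  | mul x y p ih => exact ih _
  | lt x y p ih => exact ih _

@[simp] theorem result_tabulate (m : ℕ) (f : Fin m → Comp K β) :
    (tabulate m f).result = fun i => (f i).result := by
  induction m with
  | zero => exact funext fun i => i.elim0
  | succ m ih =>
    funext i
    simp only [tabulate, result, result_bind, ih]
    cases i using Fin.cases <;> rfl

@[simp] theorem result_history (step : β → Comp K β) (t₀ : β) (m : ℕ) :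
    (history step t₀ m).result = fun i : Fin (m + 1) => (fun t => (step t).result)^[i] t₀ := by
  induction m with
  | zero => funext i; simp [history, result]
  | succ m ih =>
    funext i
    simp only [history, result, result_bind, ih]
    cases i using Fin.lastCases with
    | last => simp [Function.iterate_succ_apply']
    | cast i => simp

/-- The running best only moves up in the total preorder. `le` relates indices, not values, because
the test need be correct only on the entries of `v`. -/
theorem le_result_scan {m : ℕ} {beats : β → β → Comp K Bool} {v : Fin m → β}
    {le : Fin m → Fin m → Prop} (hrefl : ∀ i, le i i)
    (htrans : ∀ {i j l}, le i j → le j l → le i l) (htotal : ∀ {i j}, ¬ le i j → le j i)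
    (hbeats : ∀ i j, (beats (v i) (v j)).result = true ↔ ¬ le i j) (l : List (Fin m))
    (best : Fin m) :
    le best (scan beats v l best).result ∧ ∀ j ∈ l, le j (scan beats v l best).result := by
  induction l generalizing best with
  | nil => exact ⟨hrefl _, by simp⟩
  | cons j l ih =>
    simp only [scan, result, result_bind, List.forall_mem_cons]
    split_ifs with h
    · have h1 := ih j
      exact ⟨htrans (htotal ((hbeats _ _).1 h)) h1.1, h1⟩
    · have h1 := ih best
      rw [hbeats, not_not] at h
      exact ⟨h1.1, htrans h h1.1, h1.2⟩

end Result

/-- The polynomial with a given list of coefficients. -/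
noncomputable def toPoly : List ℝ → ℝ[X]
  | [] => 0
  | a :: p => Polynomial.C a + Polynomial.X * toPoly p

@[simp] theorem toPoly_nil : toPoly [] = 0 := rfl

@[simp] theorem toPoly_cons (a : ℝ) (p : List ℝ) :
    toPoly (a :: p) = Polynomial.C a + Polynomial.X * toPoly p := rfl

theorem degree_toPoly_lt (p : List ℝ) : (toPoly p).degree < p.length := by
  induction p with
  | nil => simp
  | cons a p ih =>
    rw [toPoly_cons, List.length_cons]
    refine (Polynomial.degree_add_le _ _).trans_lt (max_lt ?_ ?_)
    · exact Polynomial.degree_C_le.trans_lt (by exact_mod_cast Nat.succ_pos _)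
    · by_cases h : toPoly p = 0
      · simp [h, bot_lt_iff_ne_bot]
      · rw [Polynomial.degree_eq_natDegree h] at ih
        rw [Polynomial.degree_mul, Polynomial.degree_X, Polynomial.degree_eq_natDegree h]
        have : (toPoly p).natDegree < p.length := by exact_mod_cast ih
        exact_mod_cast (by omega : 1 + (toPoly p).natDegree < p.length + 1)

@[simp] theorem toPoly_polyAdd (p q : List ℝ) :
    toPoly (polyAdd p q).result = toPoly p + toPoly q := by
  induction p generalizing q with
  | nil => simp [polyAdd, result]
  | cons a p ih =>
    cases q with
    | nil => simp [polyAdd, result]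
    | cons b q => simp [polyAdd, result, ih]; ring

@[simp] theorem toPoly_polySub (p q : List ℝ) :
    toPoly (polySub p q).result = toPoly p - toPoly q := by
  induction q generalizing p with
  | nil => simp [polySub, result]
  | cons b q ih => cases p <;> simp [polySub, result, ih] <;> ring

@[simp] theorem toPoly_polyScale (c : ℝ) (p : List ℝ) :
    toPoly (polyScale c p).result = Polynomial.C c * toPoly p := by
  induction p with
  | nil => simp [polyScale, result]
  | cons b p ih => simp [polyScale, result, ih]; ring

@[simp] theorem toPoly_polyMul (p q : List ℝ) :
    toPoly (polyMul p q).result = toPoly p * toPoly q := by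
  induction p with
  | nil => simp [polyMul, result]
  | cons b p ih => simp [polyMul, result, ih]; ring

@[simp] theorem toPoly_polyShift (m : ℕ) (p : List ℝ) :
    toPoly (polyShift m p).result = Polynomial.X ^ m * toPoly p := by
  induction m with
  | zero => simp [polyShift, result]
  | succ m ih => simp [polyShift, result, ih]; ring

@[simp] theorem toPoly_oneSubPow (m : ℕ) :
    toPoly (oneSubPow m : Comp ℝ _).result = 1 - Polynomial.X ^ m := by
  simp [oneSubPow, result]

/-- If p = v + (1-x)q, then c + xp = (c+v) + (1-x)(xq - v). -/
theorem toPoly_deflate (p : List ℝ) :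
    toPoly p = Polynomial.C (deflate p).result.1 +
      (1 - Polynomial.X) * toPoly (deflate p).result.2 := by
  induction p with
  | nil => simp [deflate, result]
  | cons b p ih =>
    rw [toPoly_cons, ih]
    simp [deflate, result]
    ring

/-- Division by 1-x keeps the list length but lowers the degree of a nonzero polynomial, so the fuel
is measured against the degree. -/
theorem leadSign_eq_zero_or {fuel p : List ℝ} (h : (toPoly p).degree < fuel.length) :
    toPoly p = 0 ∧ (leadSign fuel p).result = 0 ∨
      ∃ (c : ℕ) (η : ℝ[X]), η.eval 1 ≠ 0 ∧ toPoly p = (1 - Polynomial.X) ^ c * η ∧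
        (leadSign fuel p).result = SignType.sign (η.eval 1) := by
  induction fuel generalizing p with
  | nil => exact Or.inl ⟨by simpa using h, rfl⟩
  | cons a fuel ih =>
    have hp := toPoly_deflate p
    simp only [leadSign, result, result_bind]
    generalize (deflate p).result = r at hp ⊢
    obtain ⟨v, q⟩ := r
    simp only [decide_eq_true_eq]
    have hv : (toPoly p).eval 1 = v := by simp [hp]
    split_ifs with hpos hneg
    · exact Or.inr ⟨0, toPoly p, by rw [hv]; exact hpos.ne', by simp,
        by rw [hv, sign_pos hpos]; rfl⟩
    · exact Or.inr ⟨0, toPoly p, by rw [hv]; exact hneg.ne, by simp,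
        by rw [hv, sign_neg hneg]; rfl⟩
    · have hv0 : v = 0 := le_antisymm (not_lt.1 hpos) (not_lt.1 hneg)
      rw [hv0, map_zero, zero_add] at hp
      have hdeg : (toPoly q).degree < fuel.length := by
        by_cases hq : toPoly q = 0
        · simp [hq, bot_lt_iff_ne_bot]
        · have h1 : (1 - Polynomial.X : ℝ[X]).degree = 1 := by
            rw [← Polynomial.degree_neg, neg_sub, ← Polynomial.C_1, Polynomial.degree_X_sub_C]
          rw [hp, Polynomial.degree_mul, h1, Polynomial.degree_eq_natDegree hq,
            List.length_cons] at h
          rw [Polynomial.degree_eq_natDegree hq]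
          have : 1 + (toPoly q).natDegree < fuel.length + 1 := by exact_mod_cast h
          exact_mod_cast (by omega : (toPoly q).natDegree < fuel.length)
      rcases ih hdeg with ⟨h1, h2⟩ | ⟨c, η, h1, h2, h3⟩
      · exact Or.inl ⟨by rw [hp, h1, mul_zero], h2⟩
      · exact Or.inr ⟨c + 1, η, h1, by rw [hp, h2]; ring, h3⟩

end Comp

/-! ### Correctness of the arithmetic of quotients -/

namespace Quot2

open Comp

/-- The rational function represented by a quotient of two coefficient lists. -/
noncomputable def toRatFunc (f : Quot2 ℝ) : RatFunc ℝ :=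
  algebraMap ℝ[X] _ (toPoly f.num) / algebraMap ℝ[X] _ (toPoly f.den)

/-- The product of the two computed signs is the sign of η(1)δ(1), or 0 when the difference
vanishes. A negative product means the reverse ordering, which asymmetry excludes. -/
theorem result_gt {f g : Quot2 ℝ} (hf : toPoly f.den ≠ 0) (hg : toPoly g.den ≠ 0) :
    (gt f g).result = true ↔ MuGT f.toRatFunc g.toRatFunc := by
  have hne : toPoly f.den * toPoly g.den ≠ 0 := mul_ne_zero hf hg
  have hsub : f.toRatFunc - g.toRatFunc =
      algebraMap ℝ[X] _ (toPoly f.num * toPoly g.den - toPoly g.num * toPoly f.den) /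
        algebraMap ℝ[X] _ (toPoly f.den * toPoly g.den) := by
    rw [toRatFunc, toRatFunc, div_sub_div _ _ (algebraMap_ne_zero hf) (algebraMap_ne_zero hg)]
    simp only [map_sub, map_mul]
    ring
  simp only [gt, result_bind, result, decide_eq_true_eq]
  have h1 := leadSign_eq_zero_or (degree_toPoly_lt
    (polySub (polyMul f.num g.den).result (polyMul g.num f.den).result).result)
  have h2 := leadSign_eq_zero_or (degree_toPoly_lt (polyMul f.den g.den).result)
  simp only [toPoly_polySub, toPoly_polyMul] at h1 h2
  obtain ⟨c₂, δ, hδ, h2, h2'⟩ := h2.resolve_left fun h => hne h.1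
  rw [h2']
  rcases h1 with ⟨h1, h1'⟩ | ⟨c₁, η, hη, h1, h1'⟩
  · rw [h1']
    rw [h1, map_zero, zero_div, sub_eq_zero] at hsub
    rw [hsub]
    simp [not_muGT_self]
  · rw [h1', ← sign_mul, sign_eq_one_iff]
    rw [h1, h2] at hsub
    refine ⟨fun h => ⟨c₁, c₂, η, δ, h, hsub⟩, fun h => ?_⟩
    by_contra hle
    exact h.asymm (muGT_of_sub_eq (lt_of_le_of_ne (not_lt.1 hle) (mul_ne_zero hη hδ)) hsub)

theorem isMuArgmax_result_argmax {m : ℕ} [NeZero m] {v : Fin m → Quot2 ℝ}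
    (hv : ∀ i, toPoly (v i).den ≠ 0) :
    IsMuArgmax Set.univ (fun i => (v i).toRatFunc) (argmax v).result :=
  ⟨trivial, fun j _ => (le_result_scan
    (le := fun i j => ¬ MuGT (v i).toRatFunc (v j).toRatFunc) (fun _ => not_muGT_self _)
    not_muGT_trans (fun h => (not_not.1 h).asymm)
    (fun i j => (result_gt (hv i) (hv j)).trans not_not.symm) _ _).2 j (List.mem_finRange j)⟩

theorem isMuArgmin_result_argmin {m : ℕ} [NeZero m] {v : Fin m → Quot2 ℝ}
    (hv : ∀ i, toPoly (v i).den ≠ 0) :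
    IsMuArgmin Set.univ (fun i => (v i).toRatFunc) (argmin v).result :=
  ⟨trivial, fun j _ => (le_result_scan
    (le := fun i j => ¬ MuGT (v j).toRatFunc (v i).toRatFunc) (fun _ => not_muGT_self _)
    (fun h₁ h₂ => not_muGT_trans h₂ h₁) (fun h => (not_not.1 h).asymm)
    (fun i j => (result_gt (hv j) (hv i)).trans not_not.symm) _ _).2 j (List.mem_finRange j)⟩

theorem den_result_backup (r : ℝ) (f : Quot2 ℝ) : (backup r f).result.den = f.den := by
  simp [backup, result]

theorem toRatFunc_result_backup (r : ℝ) {f : Quot2 ℝ} (hf : toPoly f.den ≠ 0) :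
    (backup r f).result.toRatFunc = RatFunc.C r + RatFunc.X * f.toRatFunc := by
  have h := algebraMap_ne_zero hf
  simp only [backup, result, result_bind, toRatFunc, toPoly_polyAdd, toPoly_polyScale,
    toPoly_cons, map_add, map_mul, map_zero, zero_add, RatFunc.algebraMap_C, RatFunc.algebraMap_X]
  field_simp

theorem toPoly_den_result_ratio {m : ℕ} (hm : m ≠ 0) {f g : Quot2 ℝ} (hf : toPoly f.den ≠ 0)
    (hg : toPoly g.den ≠ 0) : toPoly (ratio m f g).result.den ≠ 0 := by
  simp only [ratio, result, result_bind, toPoly_polyMul, toPoly_oneSubPow]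
  refine mul_ne_zero (mul_ne_zero hf hg) fun h => ?_
  simpa [hm] using congrArg (Polynomial.eval 0) h

theorem toRatFunc_result_ratio {m : ℕ} (hm : m ≠ 0) {f g : Quot2 ℝ} (hf : toPoly f.den ≠ 0)
    (hg : toPoly g.den ≠ 0) : (ratio m f g).result.toRatFunc =
      (f.toRatFunc - RatFunc.X ^ m * g.toRatFunc) / (1 - RatFunc.X ^ m) := by
  have h : (1 : RatFunc ℝ) - RatFunc.X ^ m ≠ 0 := by
    rw [show (1 : RatFunc ℝ) - RatFunc.X ^ m = algebraMap ℝ[X] _ (1 - Polynomial.X ^ m) by simp]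
    refine algebraMap_ne_zero fun h => ?_
    simpa [hm] using congrArg (Polynomial.eval 0) h
  have hf' := algebraMap_ne_zero hf
  have hg' := algebraMap_ne_zero hg
  simp only [ratio, result, result_bind, toRatFunc, toPoly_polyMul, toPoly_oneSubPow,
    toPoly_polySub, toPoly_polyShift, map_sub, map_mul, map_one, map_pow, RatFunc.algebraMap_X]
  field_simp

end Quot2

/-! ### The program performs a run of the procedure -/

namespace DMDP

open Comp

variable {n k : ℕ} [NeZero k] (M : DMDP ℝ n k)

theorem toPoly_den_result_sweep {f : Fin n → Quot2 ℝ × Fin k}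
    (hf : ∀ s, toPoly (f s).1.den ≠ 0) (s : Fin n) :
    toPoly ((M.sweep f).result s).1.den ≠ 0 := by
  simp [sweep, result, Quot2.den_result_backup, hf]

theorem isMuArgmax_result_sweep {f : Fin n → Quot2 ℝ × Fin k}
    (hf : ∀ s, toPoly (f s).1.den ≠ 0) (s : Fin n) :
    IsMuArgmax Set.univ (M.backup (fun s => (f s).1.toRatFunc) s) ((M.sweep f).result s).2 := by
  have h := Quot2.isMuArgmax_result_argmax
    (v := fun a => (Quot2.backup (M.reward s a) (f (M.next s a)).1).result)
    fun a => by rw [Quot2.den_result_backup]; exact hf _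
  simp only [Quot2.toRatFunc_result_backup _ (hf _)] at h
  simp only [sweep, result, result_bind, result_tabulate]
  exact h

theorem toRatFunc_result_sweep {f : Fin n → Quot2 ℝ × Fin k}
    (hf : ∀ s, toPoly (f s).1.den ≠ 0) (s : Fin n) :
    ((M.sweep f).result s).1.toRatFunc =
      M.backup (fun s => (f s).1.toRatFunc) s ((M.sweep f).result s).2 := by
  simp [sweep, result, Quot2.toRatFunc_result_backup _ (hf _), backup]

theorem toPoly_den_iterate_sweep {f : Fin n → Quot2 ℝ × Fin k}
    (hf : ∀ s, toPoly (f s).1.den ≠ 0) (i : ℕ) (s : Fin n) :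
    toPoly ((fun t => (M.sweep t).result)^[i] f s).1.den ≠ 0 := by
  induction i generalizing s with
  | zero => exact hf s
  | succ i ih =>
    rw [Function.iterate_succ_apply']
    exact M.toPoly_den_result_sweep ih s

theorem isDetMDP2Output_result [NeZero n] : M.IsDetMDP2Output M.detMDP2Blackwell.result := by
  let D : ℕ → Fin n → Quot2 ℝ × Fin k := fun i =>
    (fun t => (M.sweep t).result)^[i] fun _ => (⟨[], [1]⟩, 0)
  have hD : ∀ i s, toPoly (D i s).1.den ≠ 0 := M.toPoly_den_iterate_sweep fun s => by simp
  let c : Fin n → Fin n → Quot2 ℝ := fun s i =>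
    (Quot2.ratio (n - i) (D n s).1 (D i s).1).result
  have hni : ∀ i : Fin n, n - (i : ℕ) ≠ 0 := fun i => by have := i.2; omega
  have hc : ∀ s i, toPoly (c s i).den ≠ 0 := fun s i =>
    Quot2.toPoly_den_result_ratio (hni i) (hD _ _) (hD _ _)
  let Y : ℕ → Fin n → Quot2 ℝ × Fin k := fun i =>
    (fun t => (M.sweep t).result)^[i] fun s => (c s (Quot2.argmin (c s)).result, (D n s).2)
  have hY : ∀ i s, toPoly (Y i s).1.den ≠ 0 := M.toPoly_den_iterate_sweep fun s => hc s _
  have hcr : ∀ s i, (c s i).toRatFunc = ((D n s).1.toRatFunc -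
      RatFunc.X ^ (n - (i : ℕ)) * (D i s).1.toRatFunc) / (1 - RatFunc.X ^ (n - (i : ℕ))) :=
    fun s i => Quot2.toRatFunc_result_ratio (hni i) (hD _ _) (hD _ _)
  -- The second table has n-1+1 rows, whereas the run is indexed by i < n.
  have hn : n - 1 + 1 = n := Nat.sub_add_cancel (NeZero.one_le)
  let ib : Fin n → Fin (n - 1 + 1) := fun s => (Quot2.argmax fun i => (Y i s).1).result
  refine ⟨fun i s => (D i s).1.toRatFunc, fun i s => (Y i s).1.toRatFunc, fun i s => (D i s).2,
    fun i s => (Y i s).2, fun s => ib s, ?_⟩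
  constructor
  · intro s
    simp [D, Quot2.toRatFunc]
  · intro i _ s
    simp only [D, Function.iterate_succ_apply']
    exact M.isMuArgmax_result_sweep (hD i) s
  · intro i _ s
    simp only [D, Function.iterate_succ_apply']
    exact M.toRatFunc_result_sweep (hD i) s
  · intro s
    refine ⟨(Quot2.argmin (c s)).result, ⟨Fin.is_lt _, fun j hj => ?_⟩, hcr _ _⟩
    have h := (Quot2.isMuArgmin_result_argmin (hc s)).2 ⟨j, hj⟩ trivial
    simp only [hcr] at h
    exact h
  · intro s
    rfl
  · intro i _ s
    simp only [Y, Function.iterate_succ_apply']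
    exact M.isMuArgmax_result_sweep (hY i) s
  · intro i _ s
    simp only [Y, Function.iterate_succ_apply']
    exact M.toRatFunc_result_sweep (hY i) s
  · intro s
    refine ⟨Set.mem_Iio.2 ((ib s).2.trans_eq hn), fun j hj => ?_⟩
    exact (Quot2.isMuArgmax_result_argmax (v := fun i : Fin (n - 1 + 1) => (Y i s).1)
      fun i => hY i s).2 ⟨j, (Set.mem_Iio.1 hj).trans_eq hn.symm⟩ trivial
  · intro s
    simp only [detMDP2Blackwell, result, result_bind, result_tabulate, result_history]
    rfl

end DMDP

/-! ### Numbers of steps -/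

namespace Comp

section Steps

variable {K α β : Type} [Ring K] [LinearOrder K]

@[simp] theorem steps_bind (p : Comp K α) (f : α → Comp K β) :
    (p >>= f).steps = p.steps + (f p.result).steps := by
  change (p.bind f).steps = _
  induction p with
  | ret a => exact (Nat.zero_add _).symm
  | tick p ih => simp only [Comp.bind, steps, result, ih]; omega
  | zero p ih => simp only [Comp.bind, steps, result, ih]; omega
  | one p ih => simp only [Comp.bind, steps, result, ih]; omega
  | add x y p ih => simp only [Comp.bind, steps, result, ih]; omega
  | sub x y p ih => simp only [Comp.bind, steps, result, ih]; omega
  | mul x y p ih => simp only [Comp.bind, steps, result, ih]; omega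
  | lt x y p ih => simp only [Comp.bind, steps, result, ih]; omega

theorem steps_tabulate_le {m : ℕ} {f : Fin m → Comp K β} {B : ℕ} (h : ∀ i, (f i).steps ≤ B) :
    (tabulate m f).steps ≤ m * (B + 1) := by
  induction m with
  | zero => simp [tabulate, steps]
  | succ m ih =>
    have h1 := ih (f := fun i => f i.succ) fun i => h _
    have h0 := h 0
    simp only [tabulate, steps, steps_bind]
    rw [Nat.succ_mul]
    omega

/-- The bound is required only at the iterates actually reached, since the cost of a round grows
with the list lengths. -/
theorem steps_history_le {step : β → Comp K β} {t₀ : β} {m B : ℕ}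
    (h : ∀ i < m, (step ((fun t => (step t).result)^[i] t₀)).steps ≤ B) :
    (history step t₀ m).steps ≤ m * (B + 1) := by
  induction m with
  | zero => simp [history, steps]
  | succ m ih =>
    have h1 := ih fun i hi => h i (hi.trans m.lt_succ_self)
    have h0 := h m m.lt_succ_self
    simp only [history, steps, steps_bind, result_history, Fin.val_last]
    rw [Nat.succ_mul]
    omega

theorem steps_scan_le {m : ℕ} {beats : β → β → Comp K Bool} {v : Fin m → β} {B : ℕ}
    (h : ∀ i j, (beats (v i) (v j)).steps ≤ B) (l : List (Fin m)) (best : Fin m) :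
    (scan beats v l best).steps ≤ l.length * (B + 1) := by
  induction l generalizing best with
  | nil => simp [scan, steps]
  | cons j l ih =>
    have h0 := h j best
    simp only [scan, steps, steps_bind, List.length_cons]
    rw [Nat.succ_mul]
    split_ifs
    · have := ih j; omega
    · have := ih best; omega

theorem steps_polyAdd_le (p q : List K) : (polyAdd p q).steps ≤ p.length := by
  induction p generalizing q with
  | nil => simp [polyAdd, steps]
  | cons a p ih =>
    cases q with
    | nil => simp [polyAdd, steps]
    | cons b q => simpa [polyAdd, steps] using ih q

theorem length_polyAdd (p q : List K) :
    (polyAdd p q).result.length = max p.length q.length := by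
  induction p generalizing q with
  | nil => simp [polyAdd, result]
  | cons a p ih =>
    cases q with
    | nil => simp [polyAdd, result]
    | cons b q => simp [polyAdd, result, ih]

theorem steps_polySub_le (p q : List K) : (polySub p q).steps ≤ 2 * q.length := by
  induction q generalizing p with
  | nil => simp [polySub, steps]
  | cons b q ih =>
    cases p with
    | nil => have := ih []; simp [polySub, steps]; omega
    | cons a p => have := ih p; simp [polySub, steps]; omega

theorem length_polySub (p q : List K) :
    (polySub p q).result.length = max p.length q.length := by
  induction q generalizing p with
  | nil => simp [polySub, result]
  | cons b q ih => cases p <;> simp [polySub, result, ih]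

theorem steps_polyScale (c : K) (p : List K) : (polyScale c p).steps = p.length := by
  induction p with
  | nil => simp [polyScale, steps]
  | cons b p ih => simp [polyScale, steps, ih]

theorem length_polyScale (c : K) (p : List K) : (polyScale c p).result.length = p.length := by
  induction p with
  | nil => simp [polyScale, result]
  | cons b p ih => simp [polyScale, result, ih]

theorem steps_polyMul_le (p q : List K) :
    (polyMul p q).steps ≤ p.length * (2 * q.length + 1) := by
  induction p with
  | nil => simp [polyMul, steps]
  | cons b p ih =>
    simp only [polyMul, steps, steps_bind, steps_polyScale, List.length_cons]
    have h := steps_polyAdd_le (polyScale b q).result (0 :: (polyMul p q).result)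
    rw [length_polyScale] at h
    rw [Nat.succ_mul]
    omega

theorem length_polyMul_le (p q : List K) :
    (polyMul p q).result.length ≤ p.length + q.length := by
  induction p with
  | nil => simp [polyMul, result]
  | cons b p ih =>
    simp only [polyMul, result, result_bind, length_polyAdd, length_polyScale, List.length_cons]
    omega

theorem steps_polyShift (m : ℕ) (p : List K) : (polyShift m p).steps = m := by
  induction m with
  | zero => simp [polyShift, steps]
  | succ m ih => simp [polyShift, steps, ih]

theorem length_polyShift (m : ℕ) (p : List K) :
    (polyShift m p).result.length = p.length + m := by
  induction m with
  | zero => simp [polyShift, result]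
  | succ m ih => simp [polyShift, result, ih]; omega

theorem steps_oneSubPow_le (m : ℕ) : (oneSubPow m : Comp K _).steps ≤ 3 * m + 3 := by
  have h := steps_polySub_le [(1 : K)] (polyShift m [1]).result
  simp only [length_polyShift, List.length_singleton] at h
  simp only [oneSubPow, steps, steps_bind, steps_polyShift]
  omega

theorem length_oneSubPow (m : ℕ) : (oneSubPow m : Comp K _).result.length = m + 1 := by
  simp only [oneSubPow, result, result_bind, length_polySub, length_polyShift,
    List.length_singleton]
  omega

theorem steps_deflate (p : List K) : (deflate p).steps = 3 * p.length + 1 := by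
  induction p with
  | nil => simp [deflate, steps]
  | cons b p ih => simp [deflate, steps, ih]; omega

theorem length_deflate (p : List K) : (deflate p).result.2.length = p.length := by
  induction p with
  | nil => simp [deflate, result]
  | cons b p ih => simp [deflate, result, ih]

theorem steps_leadSign_le (fuel p : List K) :
    (leadSign fuel p).steps ≤ fuel.length * (3 * p.length + 4) := by
  induction fuel generalizing p with
  | nil => simp [leadSign, steps]
  | cons a fuel ih =>
    have h := ih (deflate p).result.2
    rw [length_deflate] at h
    simp only [leadSign, steps, steps_bind, steps_deflate, List.length_cons]
    rw [Nat.succ_mul fuel.length]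
    split_ifs <;> (try simp only [steps]) <;> omega

end Steps

end Comp

/-! ### List lengths and costs for quotients -/

namespace Quot2

open Comp

variable {K : Type}

/-- Both coefficient lists have at most `L` entries. -/
def LengthLE (f : Quot2 K) (L : ℕ) : Prop :=
  f.num.length ≤ L ∧ f.den.length ≤ L

theorem LengthLE.mono {f : Quot2 K} {L L' : ℕ} (h : f.LengthLE L) (hL : L ≤ L') :
    f.LengthLE L' :=
  ⟨h.1.trans hL, h.2.trans hL⟩

variable [Ring K] [LinearOrder K]

theorem steps_polyMul_le_of_length_le {p q : List K} {L L' : ℕ} (hp : p.length ≤ L)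
    (hq : q.length ≤ L') : (polyMul p q).steps ≤ L * (2 * L' + 1) :=
  (steps_polyMul_le p q).trans (by gcongr)

theorem steps_gt_le {f g : Quot2 K} {L : ℕ} (hf : f.LengthLE L) (hg : g.LengthLE L)
    (hL : 1 ≤ L) : (gt f g).steps ≤ 54 * L ^ 2 := by
  have h1 := steps_polyMul_le_of_length_le hf.1 hg.2
  have h2 := steps_polyMul_le_of_length_le hg.1 hf.2
  have h3 := steps_polyMul_le_of_length_le hf.2 hg.2
  have l1 : (polyMul f.num g.den).result.length ≤ 2 * L :=
    (length_polyMul_le _ _).trans (by linarith [hf.1, hg.2])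
  have l2 : (polyMul g.num f.den).result.length ≤ 2 * L :=
    (length_polyMul_le _ _).trans (by linarith [hg.1, hf.2])
  have l3 : (polyMul f.den g.den).result.length ≤ 2 * L :=
    (length_polyMul_le _ _).trans (by linarith [hf.2, hg.2])
  have h4 := steps_polySub_le (polyMul f.num g.den).result (polyMul g.num f.den).result
  have l4 := (length_polySub (polyMul f.num g.den).result (polyMul g.num f.den).result).trans_le
    (max_le l1 l2)
  have hlead : ∀ p : List K, p.length ≤ 2 * L →
      (leadSign p p).steps ≤ 2 * L * (3 * (2 * L) + 4) := fun p hp =>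
    (steps_leadSign_le p p).trans (by gcongr)
  have h5 := hlead _ l4
  have h6 := hlead _ l3
  -- The total is at most 30L² + 23L + 1, and 30 + 23 + 1 = 54.
  simp only [gt, steps, steps_bind]
  nlinarith

theorem steps_backup_le (r : K) {f : Quot2 K} {L : ℕ} (hf : f.LengthLE L) :
    (backup r f).steps ≤ 2 * L + 1 := by
  have h := steps_polyAdd_le (polyScale r f.den).result (0 :: f.num)
  rw [length_polyScale] at h
  have := hf.2
  simp only [backup, steps, steps_bind, steps_polyScale]
  omega

theorem LengthLE.result_backup (r : K) {f : Quot2 K} {L : ℕ} (hf : f.LengthLE L) :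
    (backup r f).result.LengthLE (L + 1) := by
  simp only [LengthLE, backup, result, result_bind, length_polyAdd, length_polyScale,
    List.length_cons]
  have h1 := hf.1
  have h2 := hf.2
  omega

theorem steps_ratio_le {m L : ℕ} {f g : Quot2 K} (hf : f.LengthLE L) (hg : g.LengthLE L)
    (hL : 1 ≤ L) (hm : m ≤ L) : (ratio m f g).steps ≤ 32 * L ^ 2 := by
  have h1 := steps_polyMul_le_of_length_le hf.1 hg.2
  have h2 := steps_polyMul_le_of_length_le hg.1 hf.2
  have h3 := steps_polyMul_le_of_length_le hf.2 hg.2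
  have l2 : (polyMul g.num f.den).result.length ≤ 2 * L :=
    (length_polyMul_le _ _).trans (by linarith [hg.1, hf.2])
  have l3 : (polyMul f.den g.den).result.length ≤ 2 * L :=
    (length_polyMul_le _ _).trans (by linarith [hf.2, hg.2])
  have h4 := steps_polySub_le (polyMul f.num g.den).result
    (polyShift m (polyMul g.num f.den).result).result
  rw [length_polyShift] at h4
  have h5 := steps_oneSubPow_le (K := K) m
  have h6 := steps_polyMul_le_of_length_le l3
    ((length_oneSubPow (K := K) m).trans_le (Nat.succ_le_succ hm))
  -- The total is at most 10L² + 19L + 3, and 10 + 19 + 3 = 32.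
  simp only [ratio, steps, steps_bind, steps_polyShift]
  nlinarith

theorem LengthLE.result_ratio {m L : ℕ} {f g : Quot2 K} (hf : f.LengthLE L) (hg : g.LengthLE L)
    (hL : 1 ≤ L) (hm : m ≤ L) : (ratio m f g).result.LengthLE (4 * L) := by
  have l1 := length_polyMul_le f.num g.den
  have l2 := length_polyMul_le g.num f.den
  have l3 := length_polyMul_le f.den g.den
  have l4 := length_polyMul_le (polyMul f.den g.den).result (oneSubPow m : Comp K _).result
  rw [length_oneSubPow] at l4
  obtain ⟨hf1, hf2⟩ := hf
  obtain ⟨hg1, hg2⟩ := hg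
  simp only [LengthLE, ratio, result, result_bind, length_polySub, length_polyShift]
  omega

theorem steps_argmax_le {m : ℕ} [NeZero m] {v : Fin m → Quot2 K} {L : ℕ}
    (hv : ∀ i, (v i).LengthLE L) (hL : 1 ≤ L) : (argmax v).steps ≤ m * (54 * L ^ 2 + 1) := by
  simpa [argmax] using steps_scan_le (beats := gt) (v := v)
    (fun i j => steps_gt_le (hv i) (hv j) hL) (List.finRange m) 0

theorem steps_argmin_le {m : ℕ} [NeZero m] {v : Fin m → Quot2 K} {L : ℕ}
    (hv : ∀ i, (v i).LengthLE L) (hL : 1 ≤ L) : (argmin v).steps ≤ m * (54 * L ^ 2 + 1) := by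
  simpa [argmin] using steps_scan_le (beats := fun x y => gt y x) (v := v)
    (fun i j => steps_gt_le (hv j) (hv i) hL) (List.finRange m) 0

end Quot2

/-! ### The total step count -/

namespace DMDP

open Comp

variable {K : Type} [Ring K] [LinearOrder K] {n k : ℕ} [NeZero k] (M : DMDP K n k)

theorem steps_sweep_le {f : Fin n → Quot2 K × Fin k} {L : ℕ} (hf : ∀ s, (f s).1.LengthLE L) :
    (M.sweep f).steps ≤ 60 * (n * k * (L + 1) ^ 2) := by
  have hk : 1 ≤ k := NeZero.one_le
  refine (steps_tabulate_le (B := k * (2 * L + 1 + 1) + k * (54 * (L + 1) ^ 2 + 1))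
    fun s => ?_).trans ?_
  · simp only [steps, steps_bind, result_tabulate]
    exact Nat.add_le_add (steps_tabulate_le fun a => Quot2.steps_backup_le _ (hf _))
      (Quot2.steps_argmax_le (fun a => (hf _).result_backup _) (Nat.succ_pos L))
  · have h : k * (2 * L + 1 + 1) + k * (54 * (L + 1) ^ 2 + 1) + 1 ≤ k * (60 * (L + 1) ^ 2) := by
      nlinarith [Nat.zero_le (k * L), Nat.zero_le (k * L ^ 2)]
    calc n * (k * (2 * L + 1 + 1) + k * (54 * (L + 1) ^ 2 + 1) + 1)
        ≤ n * (k * (60 * (L + 1) ^ 2)) := Nat.mul_le_mul_left _ h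
      _ = 60 * (n * k * (L + 1) ^ 2) := by ring

theorem lengthLE_result_sweep {f : Fin n → Quot2 K × Fin k} {L : ℕ}
    (hf : ∀ s, (f s).1.LengthLE L) (s : Fin n) : ((M.sweep f).result s).1.LengthLE (L + 1) := by
  simp only [sweep, result, result_bind, result_tabulate]
  exact (hf _).result_backup _

theorem lengthLE_iterate_sweep {f : Fin n → Quot2 K × Fin k} {L : ℕ}
    (hf : ∀ s, (f s).1.LengthLE L) (i : ℕ) (s : Fin n) :
    ((fun t => (M.sweep t).result)^[i] f s).1.LengthLE (L + i) := by
  induction i generalizing s with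
  | zero => exact hf s
  | succ i ih =>
    rw [Function.iterate_succ_apply']
    exact M.lengthLE_result_sweep ih s

theorem steps_history_sweep_le {f : Fin n → Quot2 K × Fin k} {L : ℕ}
    (hf : ∀ s, (f s).1.LengthLE L) (m : ℕ) :
    (history M.sweep f m).steps ≤ m * (60 * (n * k * (L + m) ^ 2) + 1) :=
  steps_history_le fun i hi =>
    (M.steps_sweep_le (M.lengthLE_iterate_sweep hf i)).trans (by gcongr 60 * (n * k * ?_ ^ 2); omega)

/-- Only list lengths enter: at most 1+n ≤ 2n in the first table, 4·2n = 8n for the ratios, and 9n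
in the second table. The rewards play no role, so `K` is arbitrary. -/
theorem steps_detMDP2Blackwell_le [NeZero n] :
    M.detMDP2Blackwell.steps ≤ 20000 * n ^ 4 * k := by
  have hn : 1 ≤ n := NeZero.one_le
  have hk : 1 ≤ k := NeZero.one_le
  let D₀ : Fin n → Quot2 K × Fin k := fun _ => (⟨[], [1]⟩, 0)
  let D : ℕ → Fin n → Quot2 K × Fin k := fun i => (fun t => (M.sweep t).result)^[i] D₀
  have hD₀ : ∀ s, (D₀ s).1.LengthLE 1 := fun s => ⟨Nat.zero_le _, le_rfl⟩
  have hD : ∀ i ≤ n, ∀ s, (D i s).1.LengthLE (2 * n) := fun i hi s =>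
    (M.lengthLE_iterate_sweep hD₀ i s).mono (by omega)
  let c : Fin n → Fin n → Quot2 K := fun s i =>
    (Quot2.ratio (n - i) (D n s).1 (D i s).1).result
  have hc : ∀ s i, (c s i).LengthLE (8 * n) := fun s i =>
    ((hD n le_rfl s).result_ratio (hD i i.2.le s) (by omega) (by omega)).mono (by omega)
  let Y₀ : Fin n → Quot2 K × Fin k := fun s => (c s (Quot2.argmin (c s)).result, (D n s).2)
  have hY₀ : ∀ s, (Y₀ s).1.LengthLE (8 * n) := fun s => hc s _
  have h1 : (tabulate n fun _ : Fin n =>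
      (one fun o => ret ((⟨[], [o]⟩ : Quot2 K), (0 : Fin k)) : Comp K _)).steps ≤ n * (1 + 1) :=
    steps_tabulate_le fun _ => le_rfl
  have h2 := M.steps_history_sweep_le hD₀ n
  have h3 : (tabulate n fun s : Fin n => do
      let c ← tabulate n fun i : Fin n => Quot2.ratio (n - i) (D n s).1 (D i s).1
      let i ← Quot2.argmin c
      ret (c i, (D n s).2)).steps ≤
      n * (n * (32 * (2 * n) ^ 2 + 1) + n * (54 * (8 * n) ^ 2 + 1) + 1) := by
    refine steps_tabulate_le fun s => ?_
    simp only [steps, steps_bind, result_tabulate]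
    exact Nat.add_le_add (steps_tabulate_le fun i =>
      Quot2.steps_ratio_le (hD n le_rfl s) (hD i i.2.le s) (by omega) (by omega))
      (Quot2.steps_argmin_le (hc s) (by omega))
  have h4 := M.steps_history_sweep_le hY₀ (n - 1)
  have h5 : (tabulate n fun s : Fin n => do
      let i ← Quot2.argmax fun i : Fin (n - 1 + 1) =>
        ((fun t => (M.sweep t).result)^[i] Y₀ s).1
      ret ((fun t => (M.sweep t).result)^[i] Y₀ s).2 : Comp K _).steps ≤
      n * ((n - 1 + 1) * (54 * (9 * n) ^ 2 + 1) + 1) := by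
    refine steps_tabulate_le fun s => ?_
    simp only [steps, steps_bind]
    exact Quot2.steps_argmax_le
      (fun i => (M.lengthLE_iterate_sweep hY₀ i s).mono (by omega)) (by omega)
  have hle := Nat.add_le_add h1 (Nat.add_le_add h2 (Nat.add_le_add h3 (Nat.add_le_add h4 h5)))
  refine le_trans ?_ (hle.trans ?_)
  -- Unfolding splits the count into the five phases, with each table replaced by its computed
  -- result.
  · conv_lhs =>
      simp only [detMDP2Blackwell, steps_bind, result_bind, result, result_tabulate,
        result_history, Fin.val_last, Fin.val_castSucc]
  have hpred : n - 1 ≤ n := n.sub_le 1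
  have e1 : n ≤ n ^ 4 * k := (Nat.le_self_pow (by omega) n).trans (Nat.le_mul_of_pos_right _ hk)
  have e2 : n ^ 2 ≤ n ^ 4 * k :=
    (Nat.pow_le_pow_right hn (by omega)).trans (Nat.le_mul_of_pos_right _ hk)
  have e4 : n ^ 4 ≤ n ^ 4 * k := Nat.le_mul_of_pos_right _ hk
  have b2 : n * (60 * (n * k * (1 + n) ^ 2) + 1) ≤ 240 * (n ^ 4 * k) + n := by
    calc n * (60 * (n * k * (1 + n) ^ 2) + 1)
        ≤ n * (60 * (n * k * (n + n) ^ 2) + 1) := by gcongr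
      _ = _ := by ring
  have b4 : (n - 1) * (60 * (n * k * (8 * n + (n - 1)) ^ 2) + 1) ≤ 4860 * (n ^ 4 * k) + n := by
    calc (n - 1) * (60 * (n * k * (8 * n + (n - 1)) ^ 2) + 1)
        ≤ n * (60 * (n * k * (8 * n + n) ^ 2) + 1) := by gcongr
      _ = _ := by ring
  rw [Nat.sub_add_cancel hn]
  have b3 : n * (n * (32 * (2 * n) ^ 2 + 1) + n * (54 * (8 * n) ^ 2 + 1) + 1) =
      3584 * n ^ 4 + 2 * n ^ 2 + n := by ring
  have b5 : n * (n * (54 * (9 * n) ^ 2 + 1) + 1) = 4374 * n ^ 4 + n ^ 2 + n := by ring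
  rw [b3, b5, mul_assoc 20000]
  -- The coefficients of n⁴k and n⁴ sum to 240 + 4860 + 3584 + 4374 = 13058; the lower-order terms
  -- add at most 9n⁴k.
  omega

end DMDP

theorem mainTheorem2 :
    (∀ (n k : ℕ) [NeZero n] [NeZero k] (M : DMDP ℝ n k) (π : Fin n → Fin k),
      M.IsDetMDP2Output π → M.toMDP.IsBlackwellOptimal π) ∧
    ∃ C : ℕ, ∀ (n k : ℕ) [NeZero n] [NeZero k] (M : DMDP ℝ n k),
      M.IsDetMDP2Output M.detMDP2Blackwell.result ∧
      M.toMDP.IsBlackwellOptimal M.detMDP2Blackwell.result ∧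
      M.detMDP2Blackwell.steps ≤ C * n ^ 4 * k := by
  refine ⟨fun n k _ _ M π h => h.isBlackwellOptimal, 20000, fun n k _ _ M => ?_⟩
  exact ⟨M.isDetMDP2Output_result, M.isDetMDP2Output_result.isBlackwellOptimal,
    M.steps_detMDP2Blackwell_le⟩
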